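/- **Setting.** For every sample size $n$ let $p=p_n\ge 1$, let $\vartheta_0\in(0,1)$ be fixed, $k_0=\lfloor n\vartheta_0\rfloor$, and consider $$X_j=\mu+\eta_j\quad(j\le k_0),\qquad X_j=\mu+\delta+\rho_j\quad(j>k_0),$$ where $\mu,\delta\in\mathbb R^p$ are deterministic, $\eta_j=f_1(\varepsilon_j,\varepsilon_{j-1},\dots)$ and $\rho_j=f_2(\varepsilon_j,\varepsilon_{j-1},\dots)$ are centred and square integrable, $(\varepsilon_j)_{j\in\mathbb Z}$ are i.i.d. in a measurable space, and $f_1,f_2$ are measurable (the errors may depend on $n$, but not on $\delta$). The centred series $X_j-\mathbb E X_j$, $j\in\mathbb Z$, is second-order stationary. Put $\Sigma_h=\mathrm{Cov}(X_0,X_h)$, $\bar\Gamma=\sum_{h\in\mathbb Z}|\Sigma_h|$ (entrywise absolute values), $\|\cdot\|$ for the spectral and $\|\cdot\|_F$ for the Frobenius norm of a matrix, and $\|\delta\|^2=p^{-1}\sum_{\ell=1}^p\delta_\ell^2$. **Test.** For $m\in\mathbb N$ let $N_m(k)=\#\{(i_1,i_2): 1\le i_1,i_2\le k,\ |i_1-i_2|>m\}$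 and, for $\lambda\in[0,1]$, $$T_n(k,m;\lambda)=\frac{1}{N_m(k)N_m(n-k)p}\sum_{\substack{i_1,i_2=1\\|i_1-i_2|>m}}^{\lfloor\lambda k\rfloor}\ \sum_{\substack{j_1,j_2=k+1\\|j_1-j_2|>m}}^{k+\lfloor\lambda(n-k)\rfloor}(X_{i_1}-X_{j_1})^\top(X_{i_2}-X_{j_2}),$$ with $T_n(k,m;\lambda)=0$ if $k\le m+1$ or $k+m\ge n-1$, and $T_n(k,m)=T_n(k,m;1)$. Let $\hat k_n$ be any (measurable) maximizer over $1\le k\le n$ of $$\Big\|\tfrac{k(n-k)}{n^2}\Big(\tfrac1k\sum_{j\le k}X_j-\tfrac1{n-k}\sum_{k<j\le n}X_j\Big)\Big\|_2^2$$ (read as $0$ for $k=n$). Let $\nu$ be a probability measure on $[0,1]$ with $\nu((0,1))>0$, and $$\Lambda_n(\lambda)=\frac{N_m(\lfloor\lambda\hat k_n\rfloor)}{N_m(\hat k_n)}\frac{N_m(\lfloor\lambda(n-\hat k_n)\rfloor)}{N_m(n-\hat k_n)},\qquad V_n=\Big(\int_0^1\big(T_n(\hat k_n,m;\lambda)-\Lambda_n(\lambda)T_n(\hat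 k_n,m)\big)^2d\nu(\lambda)\Big)^{1/2}$$ (a ratio with denominator $0$ is read as $0$). For $\alpha\in(0,1)$ let $q_{1-\alpha}$ be the $(1-\alpha)$-quantile of $\mathbb B(1)\big/\big(\int_0^1\lambda^6(\mathbb B(\lambda)-\lambda\mathbb B(1))^2d\nu(\lambda)\big)^{1/2}$, where $\mathbb B$ is a standard Brownian motion. Let $\Delta>0$. The test rejects when $T_n(\hat k_n,m)>\Delta+q_{1-\alpha}V_n$. **Theorem.** Assume that, as $n\to\infty$, with $m=m_n$, 1. $\sum_{h=0}^\infty\|\Sigma_h\|<\infty$ for each $n$, and $\sum_{h=0}^\infty\|\Sigma_h\|=o(\|\bar\Gamma\|_F)$; 2. $\mathrm{tr}^2(\bar\Gamma)=O(\|\bar\Gamma\|_F^2)$; 3. the coordinates of $X_j$ have finite fourth moments and there are constants $K$ and $\rho\in(0,1)$ such that for all large $n$ and all $j,h_1,h_2,h_3\in\mathbb Z$ $$\sum_{\ell_1,\ell_2=1}^p\big|\mathrm{cum}(X_{j,\ell_1},X_{j+h_1,\ell_1},X_{j+h_2,\ell_2},X_{j+h_3,\ell_2})\big|\le K\,\|\bar\Gamma\|_F^2\,\rho^{\max_ih_i-\min_ih_i};$$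 4. $m\to\infty$ and $m^{3/2}=o(n)$; 5. $p=O(n\,\|\bar\Gamma\|_F)$. Let $C>0$, $\mathcal A_n=\{\delta\in\mathbb R^p:\|\delta\|^2>\Delta+\|\bar\Gamma\|_F/p\}$ and $\mathcal B_n=\{\delta\in\mathbb R^p: C\le\|\delta\|^2<\Delta-\|\bar\Gamma\|_F/p\}$. Then $$\liminf_{n\to\infty}\inf_{\delta\in\mathcal A_n}\mathbb P\big(T_n(\hat k_n,m)>\Delta+q_{1-\alpha}V_n\big)=1,\qquad \limsup_{n\to\infty}\sup_{\delta\in\mathcal B_n}\mathbb P\big(T_n(\hat k_n,m)>\Delta+q_{1-\alpha}V_n\big)=0,$$ where the supremum over an empty set is $0$. -/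

import Mathlib

open MeasureTheory ProbabilityTheory Filter Topology Asymptotics
open scoped ENNReal NNReal Matrix

namespace RelevantChange

noncomputable section

/-! ### Error processes and the observed time series -/

/-- The causal Bernoulli shift `f (ε_j, ε_{j-1}, ε_{j-2}, …)`, `j ∈ ℤ`. -/
def bernoulliShift {Ω S : Type*} {p : ℕ} (ε : ℤ → Ω → S) (f : (ℕ → S) → Fin p → ℝ)
    (j : ℤ) (ω : Ω) : Fin p → ℝ :=
  f fun k => ε (j - k) ω

/-- The centred time series with a change at time `k₀`: it equals `η_j` for `j ≤ k₀` and `ρ_j` for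
`j > k₀`, where `η` and `ρ` are the Bernoulli shifts given by `f₁` and `f₂`. -/
def noise {Ω S : Type*} {p : ℕ} (k₀ : ℕ) (ε : ℤ → Ω → S) (f₁ f₂ : (ℕ → S) → Fin p → ℝ)
    (j : ℤ) (ω : Ω) : Fin p → ℝ :=
  if j ≤ (k₀ : ℤ) then bernoulliShift ε f₁ j ω else bernoulliShift ε f₂ j ω

/-- The observations `X_j = μ + η_j` for `j ≤ k₀` and `X_j = μ + ρ_j + δ` for `j > k₀`, as a
function of the centred series `U` (the series `noise`). -/
def obs {Ω : Type*} {p : ℕ} (μ δ : Fin p → ℝ) (k₀ : ℕ) (U : ℤ → Ω → Fin p → ℝ)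
    (ω : Ω) (j : ℕ) : Fin p → ℝ :=
  μ + U j ω + if j ≤ k₀ then 0 else δ

/-- The lag-`h` autocovariance matrix `Σ_h = Cov (U_0, U_h)`. As `X_j` and `U_j` differ by the
deterministic vector `𝔼 X_j`, this is also `Cov (X_0, X_h)`. -/
def autocov {Ω : Type*} [MeasurableSpace Ω] {p : ℕ} (P : Measure Ω) (U : ℤ → Ω → Fin p → ℝ)
    (h : ℤ) : Matrix (Fin p) (Fin p) ℝ :=
  Matrix.of fun a b => cov[fun ω => U 0 ω a, fun ω => U h ω b; P]

/-- The assumptions on the error processes for one sample size: the innovations are i.i.d., the two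
Bernoulli shifts are measurable, square integrable and centred, and the centred time series is
second-order stationary, so that `Cov (X_i, X_j) = Σ_{j-i}`. -/
structure IsErrorModel {Ω S : Type*} [MeasurableSpace Ω] [MeasurableSpace S] {p : ℕ}
    (P : Measure Ω) (k₀ : ℕ) (ε : ℤ → Ω → S) (f₁ f₂ : (ℕ → S) → Fin p → ℝ) : Prop where
  measurable_innovation : ∀ j, Measurable (ε j)
  indep : iIndepFun ε P
  identDistrib : ∀ j, IdentDistrib (ε j) (ε 0) P P
  measurable_f₁ : Measurable f₁
  measurable_f₂ : Measurable f₂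
  memLp_eta : ∀ j a, MemLp (fun ω => bernoulliShift ε f₁ j ω a) 2 P
  memLp_rho : ∀ j a, MemLp (fun ω => bernoulliShift ε f₂ j ω a) 2 P
  centred_eta : ∀ j a, ∫ ω, bernoulliShift ε f₁ j ω a ∂P = 0
  centred_rho : ∀ j a, ∫ ω, bernoulliShift ε f₂ j ω a ∂P = 0
  stationary : ∀ (i j : ℤ) (a b : Fin p),
    cov[fun ω => noise k₀ ε f₁ f₂ i ω a, fun ω => noise k₀ ε f₁ f₂ j ω b; P]
      = autocov P (noise k₀ ε f₁ f₂) (j - i) a b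

/-! ### Matrix quantities -/

/-- The spectral norm. -/
def spectralNorm {p : ℕ} (A : Matrix (Fin p) (Fin p) ℝ) : ℝ :=
  ‖Matrix.toEuclideanCLM (𝕜 := ℝ) A‖

/-- The Frobenius norm. -/
def frobNorm {p : ℕ} (A : Matrix (Fin p) (Fin p) ℝ) : ℝ :=
  √(∑ a, ∑ b, A a b ^ 2)

/-- `Γ̄ = ∑_{h ∈ ℤ} |Σ_h|` with entrywise absolute values. -/
def gammaBar {Ω : Type*} [MeasurableSpace Ω] {p : ℕ} (P : Measure Ω) (U : ℤ → Ω → Fin p → ℝ) :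
    Matrix (Fin p) (Fin p) ℝ :=
  Matrix.of fun a b => ∑' h : ℤ, |autocov P U h a b|

/-- The squared normalized norm `‖δ‖² = ‖δ‖₂² / p`. -/
def normSq {p : ℕ} (δ : Fin p → ℝ) : ℝ := (∑ l, δ l ^ 2) / p

/-- The joint fourth order cumulant of four random variables with finite fourth moments. -/
def cum₄ {Ω : Type*} [MeasurableSpace Ω] (P : Measure Ω) (Y₁ Y₂ Y₃ Y₄ : Ω → ℝ) : ℝ :=
  (∫ ω, (Y₁ ω - ∫ v, Y₁ v ∂P) * (Y₂ ω - ∫ v, Y₂ v ∂P) * (Y₃ ω - ∫ v, Y₃ v ∂P)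
      * (Y₄ ω - ∫ v, Y₄ v ∂P) ∂P)
    - cov[Y₁, Y₂; P] * cov[Y₃, Y₄; P] - cov[Y₁, Y₃; P] * cov[Y₂, Y₄; P]
    - cov[Y₁, Y₄; P] * cov[Y₂, Y₃; P]

/-- The cumulant bound with constants `K` and `r` for one sample size. The cumulants are taken along
`(j, j + h₁, j + h₂, j + h₃)` for every base point `j`. -/
def CumulantBound {Ω : Type*} [MeasurableSpace Ω] {p : ℕ} (P : Measure Ω)
    (U : ℤ → Ω → Fin p → ℝ) (K r : ℝ) : Prop :=
  (∀ j a, MemLp (fun ω => U j ω a) 4 P) ∧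
    ∀ j h₁ h₂ h₃ : ℤ,
      ∑ a, ∑ b, |cum₄ P (fun ω => U j ω a) (fun ω => U (j + h₁) ω a)
          (fun ω => U (j + h₂) ω b) (fun ω => U (j + h₃) ω b)|
        ≤ K * frobNorm (gammaBar P U) ^ 2 * r ^ (max h₁ (max h₂ h₃) - min h₁ (min h₂ h₃))

/-! ### The test

The statistics are functions of a data path `x 1, …, x n`. -/

/-- The pairs `(i₁, i₂)` with `a < i₁, i₂ ≤ b` and `|i₁ - i₂| > m`. -/
def sepPairs (m a b : ℕ) : Finset (ℕ × ℕ) :=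
  (Finset.Ioc a b ×ˢ Finset.Ioc a b).filter fun i => (m : ℤ) < |(i.1 : ℤ) - (i.2 : ℤ)|

/-- `N_m(k)`, the number of pairs `1 ≤ i₁, i₂ ≤ k` with `|i₁ - i₂| > m`. -/
def numPairs (m k : ℕ) : ℝ := (sepPairs m 0 k).card

/-- The sequential statistic `T_n(k, m; l)`. -/
def seqStat {p : ℕ} (n m k : ℕ) (x : ℕ → Fin p → ℝ) (l : ℝ) : ℝ :=
  if k ≤ m + 1 ∨ n ≤ k + m + 1 then 0 else
    (1 / (numPairs m k * numPairs m (n - k) * p)) *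
      ∑ i ∈ sepPairs m 0 ⌊l * (k : ℝ)⌋₊,
        ∑ j ∈ sepPairs m k (k + ⌊l * ((n - k : ℕ) : ℝ)⌋₊),
          (x i.1 - x j.1) ⬝ᵥ (x i.2 - x j.2)

/-- The statistic `T_n(k, m) = T_n(k, m; 1)`. -/
def stat {p : ℕ} (n m k : ℕ) (x : ℕ → Fin p → ℝ) : ℝ := seqStat n m k x 1

/-- The centring factor `Λ_n(l)` of the self-normalizer. -/
def centring (n m k : ℕ) (l : ℝ) : ℝ :=
  numPairs m ⌊l * (k : ℝ)⌋₊ / numPairs m k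
    * (numPairs m ⌊l * ((n - k : ℕ) : ℝ)⌋₊ / numPairs m (n - k))

/-- The self-normalizer `V_n`. -/
def selfNormalizer {p : ℕ} (ν : Measure unitInterval) (n m k : ℕ) (x : ℕ → Fin p → ℝ) : ℝ :=
  √(∫ l : unitInterval, (seqStat n m k x l - centring n m k l * stat n m k x) ^ 2 ∂ν)

/-- The objective function of the change point estimator. At `k = n` its value is `0`. -/
def cusumSq {p : ℕ} (n : ℕ) (x : ℕ → Fin p → ℝ) (k : ℕ) : ℝ :=
  ∑ a, ((k : ℝ) * ((n : ℝ) - k) / (n : ℝ) ^ 2 *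
    (1 / (k : ℝ) * (∑ j ∈ Finset.Icc 1 k, x j a)
      - 1 / ((n : ℝ) - k) * ∑ j ∈ Finset.Ioc k n, x j a)) ^ 2

/-- `k` maximizes the objective function over `{1, …, n}`. -/
def IsChangePointEstimate {p : ℕ} (n : ℕ) (x : ℕ → Fin p → ℝ) (k : ℕ) : Prop :=
  k ∈ Finset.Icc 1 n ∧ ∀ k' ∈ Finset.Icc 1 n, cusumSq n x k' ≤ cusumSq n x k

/-- The test with critical value `q` and change point estimate `k` rejects the null hypothesis. -/
def Rejects {p : ℕ} (ν : Measure unitInterval) (q Δ : ℝ) (n m k : ℕ) (x : ℕ → Fin p → ℝ) : Prop :=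
  Δ + q * selfNormalizer ν n m k x < stat n m k x

/-- The random variable `𝔾 = B(1) / (∫ l⁶ (B(l) - l B(1))² dν(l))^{1/2}`. -/
def pivot {Ω : Type*} (ν : Measure unitInterval) (B : ℝ≥0 → Ω → ℝ) (ω : Ω) : ℝ :=
  B 1 ω / √(∫ l : unitInterval,
    (l : ℝ) ^ 6 * (B (unitInterval.toNNReal l) ω - (l : ℝ) * B 1 ω) ^ 2 ∂ν)

/-- The `u`-quantile of the distribution of `Y`. -/
def quantile {Ω : Type*} [MeasurableSpace Ω] (P : Measure Ω) (Y : Ω → ℝ) (u : ℝ) : ℝ :=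
  sInf {x : ℝ | u ≤ P.real {ω | Y ω ≤ x}}

/-! ### The local alternatives and null hypotheses -/

/-- `𝒜_n = {δ : ‖δ‖² > Δ + ‖Γ̄‖_F / p}`. -/
def alternatives {p : ℕ} (Δ : ℝ) (G : Matrix (Fin p) (Fin p) ℝ) : Set (Fin p → ℝ) :=
  {δ | Δ + frobNorm G / p < normSq δ}

/-- `ℬ_n = {δ : C ≤ ‖δ‖² < Δ - ‖Γ̄‖_F / p}`. -/
def nulls {p : ℕ} (C Δ : ℝ) (G : Matrix (Fin p) (Fin p) ℝ) : Set (Fin p → ℝ) :=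
  {δ | C ≤ normSq δ ∧ normSq δ < Δ - frobNorm G / p}

end

end RelevantChange

namespace RelevantChange

open Finset RealInnerProductSpace

/-! ### Sums over separated pairs -/

/-! Write D for `normSq δ`, g = ‖Γ̄‖_F / p and γ = min 1 g. Both claims follow from one uniform
estimate: for every fixed ζ > 0, with probability close to 1, |T_n - D| and V_n are at most ζ γ D.
On 𝒜_n and ℬ_n the value D stays at distance g from Δ. The total error ζ (1 + |q|) γ D is smaller
than the gap: if D ≤ 2Δ it is a small multiple of γ ≤ g, and if D ≥ 2Δ the gap is at least D / 2. No
distributional limit is needed, since q is a fixed number multiplying a negligible V_n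
(`rejects_of_mem_alternatives`, `not_rejects_of_mem_nulls`).

The estimate has a deterministic half. `IsSmallNoise` lists what a noise path u must satisfy
relative to the signal d. The CUSUM process is its noise version minus a tent function times d, and
comparing squared norms at the estimate and at k₀ gives |k̂ - k₀| M ≤ θ² n γ
(`abs_sub_le_of_norm_cusum_le`). Next, k̂ is declared to be the change and the few misclassified
observations are moved into the noise, so that the quadruple sum expands exactly (`quadSum_eq`). The
quadratic noise terms are of order θ n⁴ γ ‖d‖². The terms linear in the noise are compared with
those at k₀, whose windows are deterministic (`abs_quadSum_sub_le`). In V_n the centring cancels D,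
so V_n inherits the error of T_n (`abs_stat_sub_le_and_selfNormalizer_le`).

The probabilistic half uses only second moments and Markov's inequality
(`measure_not_isSmallNoise_le`). Energy and partial sums are governed by tr Γ̄, which is at most a
multiple of ‖Γ̄‖_F. Linear forms ⟨δ, ·⟩ are governed by ∑ ‖Σ_h‖ = o(‖Γ̄‖_F), and this gain pays for
a union bound over all k far from k₀. The condition p = O(n ‖Γ̄‖_F) keeps n γ away from 0. The
constants are fixed in the order θ, M, ξ, τ, and then n is taken large
(`eventually_measure_stat_sub_le`). -/

theorem mem_sepPairs {m a b : ℕ} {i : ℕ × ℕ} :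
    i ∈ sepPairs m a b ↔ (i.1 ∈ Ioc a b ∧ i.2 ∈ Ioc a b) ∧ (m : ℤ) < |(i.1 : ℤ) - (i.2 : ℤ)| := by
  simp [sepPairs]

theorem sum_sepPairs_swap {M : Type*} [AddCommMonoid M] (m a b : ℕ) (f : ℕ × ℕ → M) :
    ∑ i ∈ sepPairs m a b, f i.swap = ∑ i ∈ sepPairs m a b, f i := by
  refine Finset.sum_nbij' Prod.swap Prod.swap ?_ ?_ ?_ ?_ ?_ <;> intro i
  · simp only [mem_sepPairs, Prod.fst_swap, Prod.snd_swap]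
    rw [abs_sub_comm]; tauto
  · simp only [mem_sepPairs, Prod.fst_swap, Prod.snd_swap]
    rw [abs_sub_comm]; tauto
  · simp
  · simp
  · simp

theorem sum_sepPairs_snd {M : Type*} [AddCommMonoid M] (m a b : ℕ) (f : ℕ → M) :
    ∑ i ∈ sepPairs m a b, f i.2 = ∑ i ∈ sepPairs m a b, f i.1 :=
  sum_sepPairs_swap m a b fun i => f i.1

theorem card_sepPairs_add (m k b : ℕ) :
    ((sepPairs m k (k + b)).card : ℝ) = numPairs m b := by
  unfold numPairs
  congr 1
  refine (Finset.card_nbij' (fun i : ℕ × ℕ => (i.1 + k, i.2 + k))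
    (fun i : ℕ × ℕ => (i.1 - k, i.2 - k)) ?_ ?_ ?_ ?_).symm
  · intro i hi
    simp only [SetLike.mem_coe, mem_sepPairs, Finset.mem_Ioc] at hi ⊢
    push_cast
    rw [add_sub_add_right_eq_sub]
    omega
  · intro i hi
    simp only [SetLike.mem_coe, mem_sepPairs, Finset.mem_Ioc] at hi ⊢
    rw [Nat.cast_sub (by omega), Nat.cast_sub (by omega), sub_sub_sub_cancel_right]
    omega
  · intro i hi
    simp
  · intro i hi
    simp only [SetLike.mem_coe, mem_sepPairs, Finset.mem_Ioc] at hi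
    ext <;> simp <;> omega

theorem card_near_le (m a b i : ℕ) :
    #((Ioc a b).filter fun j : ℕ => ¬ (m : ℤ) < |(i : ℤ) - (j : ℤ)|) ≤ 2 * m + 1 := by
  calc _ ≤ #(Icc (i - m) (i + m)) := by
        refine card_le_card fun j hj => ?_
        simp only [Finset.mem_filter, Finset.mem_Icc, not_lt, abs_le] at hj ⊢
        omega
    _ ≤ 2 * m + 1 := by simp; omega

/-- The pairs that are not separated. -/
def nearPairs (m a b : ℕ) : Finset (ℕ × ℕ) :=
  (Finset.Ioc a b ×ˢ Finset.Ioc a b).filter fun i => ¬ (m : ℤ) < |(i.1 : ℤ) - (i.2 : ℤ)|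

theorem sum_sepPairs_add_sum_nearPairs {M : Type*} [AddCommMonoid M] (m a b : ℕ)
    (f : ℕ × ℕ → M) :
    ∑ i ∈ sepPairs m a b, f i + ∑ i ∈ nearPairs m a b, f i
      = ∑ i ∈ Ioc a b, ∑ j ∈ Ioc a b, f (i, j) := by
  rw [sepPairs, nearPairs, sum_filter_add_sum_filter_not, sum_product]

theorem sum_nearPairs_fst_le (m a b : ℕ) (f : ℕ → ℝ) (hf : ∀ i, 0 ≤ f i) :
    ∑ i ∈ nearPairs m a b, f i.1 ≤ (2 * m + 1) * ∑ i ∈ Ioc a b, f i := by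
  rw [nearPairs, sum_filter, sum_product, mul_sum]
  refine sum_le_sum fun i _ => ?_
  simp only [← sum_filter, sum_const, nsmul_eq_mul]
  refine mul_le_mul_of_nonneg_right ?_ (hf i)
  exact_mod_cast card_near_le m a b i

theorem sum_nearPairs_snd_le (m a b : ℕ) (f : ℕ → ℝ) (hf : ∀ i, 0 ≤ f i) :
    ∑ i ∈ nearPairs m a b, f i.2 ≤ (2 * m + 1) * ∑ i ∈ Ioc a b, f i := by
  rw [nearPairs, sum_filter, sum_product_right, mul_sum]
  refine sum_le_sum fun i _ => ?_
  simp only [← sum_filter, sum_const, nsmul_eq_mul]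
  refine mul_le_mul_of_nonneg_right ?_ (hf i)
  have := card_near_le m a b i
  simp_rw [abs_sub_comm (i : ℤ)] at this
  exact_mod_cast this

/-! ### Counting separated pairs. -/

theorem numPairs_nonneg (m k : ℕ) : 0 ≤ numPairs m k := Nat.cast_nonneg _

theorem numPairs_le_sq (m k : ℕ) : numPairs m k ≤ (k : ℝ) ^ 2 := by
  unfold numPairs sepPairs
  have := card_filter_le (Ioc 0 k ×ˢ Ioc 0 k) fun i => (m : ℤ) < |(i.1 : ℤ) - (i.2 : ℤ)|
  rw [card_product, Nat.card_Ioc, Nat.sub_zero] at this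
  rw [sq]
  exact_mod_cast this

theorem numPairs_mono (m : ℕ) {k l : ℕ} (h : k ≤ l) : numPairs m k ≤ numPairs m l := by
  unfold numPairs
  exact_mod_cast card_le_card fun i hi => by
    simp only [mem_sepPairs, Finset.mem_Ioc] at hi ⊢
    omega

theorem le_numPairs (m k : ℕ) : (k : ℝ) * (k - (2 * m + 1)) ≤ numPairs m k := by
  have h1 := sum_sepPairs_add_sum_nearPairs m 0 k fun _ => (1 : ℝ)
  have h2 := sum_nearPairs_fst_le m 0 k (fun _ => (1 : ℝ)) fun _ => zero_le_one
  simp only [sum_const, Nat.card_Ioc, Nat.sub_zero, nsmul_eq_mul, mul_one] at h1 h2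
  unfold numPairs
  nlinarith

/-! ### Quadratic and linear forms over separated pairs. -/

section InnerProduct

variable {E : Type*} [NormedAddCommGroup E] [InnerProductSpace ℝ E]

/-- The quadratic form `∑ ⟪v i, v j⟫` over separated pairs. -/
noncomputable def pairForm (m a b : ℕ) (v : ℕ → E) : ℝ :=
  ∑ i ∈ sepPairs m a b, ⟪v i.1, v i.2⟫

/-- The sum of the first components `v i` over separated pairs `(i, j)`. -/
noncomputable def pairSum {V : Type*} [AddCommMonoid V] (m a b : ℕ) (v : ℕ → V) : V :=
  ∑ i ∈ sepPairs m a b, v i.1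

/-- All pairs together give the squared norm of the sum. The removed near-diagonal pairs are bounded
by AM-GM, each index having at most `2 * m + 1` neighbours, so trimming is a lower-order correction
for m = o(n). -/
theorem abs_pairForm_le (m a b : ℕ) (v : ℕ → E) :
    |pairForm m a b v| ≤ ‖∑ i ∈ Ioc a b, v i‖ ^ 2 + (2 * m + 1) * ∑ i ∈ Ioc a b, ‖v i‖ ^ 2 := by
  have h1 := sum_sepPairs_add_sum_nearPairs m a b fun i => ⟪v i.1, v i.2⟫
  have h2 : ∑ i ∈ Ioc a b, ∑ j ∈ Ioc a b, ⟪v i, v j⟫ = ‖∑ i ∈ Ioc a b, v i‖ ^ 2 := by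
    rw [← real_inner_self_eq_norm_sq, sum_inner]
    simp_rw [inner_sum]
  have h3 : |∑ i ∈ nearPairs m a b, ⟪v i.1, v i.2⟫|
      ≤ (2 * m + 1) * ∑ i ∈ Ioc a b, ‖v i‖ ^ 2 := by
    calc _ ≤ ∑ i ∈ nearPairs m a b, |⟪v i.1, v i.2⟫| := abs_sum_le_sum_abs _ _
      _ ≤ ∑ i ∈ nearPairs m a b, (1 / 2 * ‖v i.1‖ ^ 2 + 1 / 2 * ‖v i.2‖ ^ 2) := by
          refine sum_le_sum fun i _ => ?_
          have := abs_real_inner_le_norm (v i.1) (v i.2)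
          nlinarith [sq_nonneg (‖v i.1‖ - ‖v i.2‖)]
      _ ≤ _ := by
          rw [sum_add_distrib, ← mul_sum, ← mul_sum]
          have h4 := sum_nearPairs_fst_le m a b (fun i => ‖v i‖ ^ 2) fun i => by positivity
          have h5 := sum_nearPairs_snd_le m a b (fun i => ‖v i‖ ^ 2) fun i => by positivity
          linarith
  have h4 : pairForm m a b v
      = ‖∑ i ∈ Ioc a b, v i‖ ^ 2 - ∑ i ∈ nearPairs m a b, ⟪v i.1, v i.2⟫ := by
    rw [pairForm, ← h2, ← h1]; ring
  rw [h4]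
  refine (abs_sub _ _).trans (add_le_add (abs_of_nonneg (by positivity)).le h3)

theorem norm_pairSum_le (m a b : ℕ) (v : ℕ → E) :
    ‖pairSum m a b v‖ ≤ (b - a : ℕ) * ‖∑ i ∈ Ioc a b, v i‖
      + (2 * m + 1) * ∑ i ∈ Ioc a b, ‖v i‖ := by
  have h1 := sum_sepPairs_add_sum_nearPairs m a b fun i => v i.1
  have h4 : pairSum m a b v
      = (b - a) • ∑ i ∈ Ioc a b, v i - ∑ i ∈ nearPairs m a b, v i.1 := by
    rw [pairSum, eq_sub_iff_add_eq, h1, smul_sum]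
    simp
  rw [h4]
  refine (norm_sub_le _ _).trans (add_le_add ?_ ?_)
  · rw [← Nat.cast_smul_eq_nsmul ℝ, norm_smul, Real.norm_natCast]
  · exact (norm_sum_le _ _).trans (sum_nearPairs_fst_le m a b (fun i => ‖v i‖) fun i => norm_nonneg _)

theorem inner_pairSum (m a b : ℕ) (d : E) (v : ℕ → E) :
    ⟪d, pairSum m a b v⟫ = pairSum m a b fun i => ⟪d, v i⟫ := by
  rw [pairSum, inner_sum, pairSum]

theorem abs_pairSum_le (m a b : ℕ) (z : ℕ → ℝ) :
    |pairSum m a b z| ≤ (b - a : ℕ) * ∑ i ∈ Ioc a b, |z i| := by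
  calc _ ≤ ∑ i ∈ sepPairs m a b, |z i.1| := abs_sum_le_sum_abs _ _
    _ ≤ ∑ i ∈ Ioc a b ×ˢ Ioc a b, |z i.1| :=
        sum_le_sum_of_subset_of_nonneg (filter_subset _ _) fun _ _ _ => abs_nonneg _
    _ = _ := by
        rw [sum_product, mul_sum]
        simp

/-- Moving the index interval changes the sum over separated pairs by a window term. -/
theorem abs_pairSum_sub_pairSum_le (m n : ℕ) {a b a' b' : ℕ} (hb : b ≤ n) (hb' : b' ≤ n)
    (z : ℕ → ℝ) (W : Finset ℕ) (hWn : W ⊆ Ioc 0 n)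
    (hW : ∀ i, i ∉ W → (i ∈ Ioc a b ↔ i ∈ Ioc a' b')) :
    |pairSum m a b z - pairSum m a' b' z|
      ≤ n * ∑ i ∈ W, |z i| + #W * ∑ i ∈ Ioc 0 n, |z i| := by
  classical
  have key : ∀ {a b : ℕ}, b ≤ n → pairSum m a b z
      = ∑ i ∈ Ioc 0 n, ∑ j ∈ Ioc 0 n, if (i, j) ∈ sepPairs m a b then z i else 0 := by
    intro a b hb
    rw [← sum_product', ← sum_filter]
    refine sum_congr ?_ fun _ _ => rfl
    ext i
    simp only [Finset.mem_filter, mem_product, mem_sepPairs, Finset.mem_Ioc]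
    omega
  rw [key hb, key hb', ← sum_sub_distrib]
  simp_rw [← sum_sub_distrib]
  -- Outside `W` membership in the two intervals agrees, so a pair contributes only if one of its
  -- indices lies in `W`, and then at most `|z i|`.
  calc _ ≤ ∑ i ∈ Ioc 0 n, ∑ j ∈ Ioc 0 n, ((if i ∈ W then |z i| else 0) + if j ∈ W then |z i| else 0) := by
        refine (abs_sum_le_sum_abs _ _).trans (sum_le_sum fun i _ => ?_)
        refine (abs_sum_le_sum_abs _ _).trans (sum_le_sum fun j _ => ?_)
        have hi := hW i
        have hj := hW j
        have hz := abs_nonneg (z i)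
        by_cases h1 : i ∈ W <;> by_cases h2 : j ∈ W
        · simp only [h1, h2, if_true]
          split_ifs <;> simp [hz]
        · simp only [h1, h2, if_true, if_false]
          split_ifs <;> simp
        · simp only [h1, h2, if_true, if_false]
          split_ifs <;> simp
        · simp only [mem_sepPairs, hi h1, hj h2, h1, h2]
          simp
    _ = _ := by
        simp_rw [sum_add_distrib]
        congr 1
        · simp only [sum_const, Nat.card_Ioc, Nat.sub_zero, nsmul_eq_mul, ← mul_sum, ← sum_filter]
          congr 2
          rw [filter_mem_eq_inter, inter_eq_right.2 hWn]
        · simp only [← sum_filter, filter_mem_eq_inter, inter_eq_right.2 hWn, sum_const,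
            nsmul_eq_mul, mul_sum]

/-- The quadruple sum in the definition of `seqStat`. -/
noncomputable def quadSum (m a k b : ℕ) (x : ℕ → E) : ℝ :=
  ∑ i ∈ sepPairs m 0 a, ∑ j ∈ sepPairs m k (k + b), ⟪x i.1 - x j.1, x i.2 - x j.2⟫

/-- The pairs on the two sides range independently, so every mixed product factors. The identity
holds for whichever `k` is treated as the change, as long as `v` absorbs the discrepancy; it is
later applied at the estimate, not at k₀. -/
theorem quadSum_eq (m : ℕ) {a k b : ℕ} (hak : a ≤ k) (x v : ℕ → E) (d : E)
    (hl : ∀ i ≤ k, x i = v i) (hr : ∀ i, k < i → x i = v i + d) :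
    quadSum m a k b x = numPairs m b * pairForm m 0 a v + numPairs m a * pairForm m k (k + b) v
      - 2 * ⟪pairSum m 0 a v, pairSum m k (k + b) v⟫
      - 2 * numPairs m b * ⟪d, pairSum m 0 a v⟫ + 2 * numPairs m a * ⟪d, pairSum m k (k + b) v⟫
      + numPairs m a * numPairs m b * ‖d‖ ^ 2 := by
  have h1 : quadSum m a k b x = ∑ i ∈ sepPairs m 0 a, ∑ j ∈ sepPairs m k (k + b),
      (⟪v i.1, v i.2⟫ + ⟪v j.1, v j.2⟫ - ⟪v i.1, v j.2⟫ - ⟪v i.2, v j.1⟫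
        - ⟪d, v i.1⟫ - ⟪d, v i.2⟫ + ⟪d, v j.1⟫ + ⟪d, v j.2⟫ + ‖d‖ ^ 2) := by
    refine sum_congr rfl fun i hi => sum_congr rfl fun j hj => ?_
    simp only [mem_sepPairs, Finset.mem_Ioc] at hi hj
    rw [hl i.1 (by omega), hl i.2 (by omega), hr j.1 (by omega), hr j.2 (by omega)]
    simp only [inner_sub_left, inner_sub_right, inner_add_left, inner_add_right,
      ← real_inner_self_eq_norm_sq]
    rw [real_inner_comm d (v i.1), real_inner_comm d (v j.1), real_inner_comm (v i.2) (v j.1)]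
    ring
  have hd : ∀ a b, ∑ i ∈ sepPairs m a b, ⟪d, v i.2⟫ = ⟪d, pairSum m a b v⟫ := fun a b => by
    rw [sum_sepPairs_snd m a b fun i => ⟪d, v i⟫, pairSum, inner_sum]
  have hd' : ∀ a b, ∑ i ∈ sepPairs m a b, ⟪d, v i.1⟫ = ⟪d, pairSum m a b v⟫ := fun a b => by
    rw [pairSum, inner_sum]
  have hc1 : ∑ i ∈ sepPairs m 0 a, ∑ j ∈ sepPairs m k (k + b), ⟪v i.1, v j.2⟫
      = ⟪pairSum m 0 a v, pairSum m k (k + b) v⟫ := by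
    rw [pairSum, sum_inner]
    refine sum_congr rfl fun i _ => ?_
    rw [sum_sepPairs_snd m k (k + b) fun j => ⟪v i.1, v j⟫, pairSum, inner_sum]
  have hc2 : ∑ i ∈ sepPairs m 0 a, ∑ j ∈ sepPairs m k (k + b), ⟪v i.2, v j.1⟫
      = ⟪pairSum m 0 a v, pairSum m k (k + b) v⟫ := by
    rw [sum_sepPairs_snd m 0 a fun i => ∑ j ∈ sepPairs m k (k + b), ⟪v i, v j.1⟫, pairSum,
      sum_inner]
    refine sum_congr rfl fun i _ => ?_
    rw [pairSum, inner_sum]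
  rw [h1]
  simp only [sum_add_distrib, sum_sub_distrib, hc1, hc2, sum_const, nsmul_eq_mul, ← mul_sum,
    hd, hd', card_sepPairs_add]
  have h0 : ((sepPairs m 0 a).card : ℝ) = numPairs m a := rfl
  rw [h0]
  unfold pairForm
  ring

/-! ### Pathwise bounds for the change point estimator -/

theorem sq_norm_sum_le_card_mul {E : Type*} [NormedAddCommGroup E] {I J : Finset ℕ} (hIJ : I ⊆ J) (u : ℕ → E) :
    ‖∑ i ∈ I, u i‖ ^ 2 ≤ #I * ∑ i ∈ J, ‖u i‖ ^ 2 := by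
  calc _ ≤ (∑ i ∈ I, ‖u i‖) ^ 2 := by gcongr; exact norm_sum_le _ _
    _ ≤ #I * ∑ i ∈ I, ‖u i‖ ^ 2 := sq_sum_le_card_mul_sum_sq
    _ ≤ _ := by
        gcongr

theorem sum_Ioc_zero_sub {E : Type*} [AddCommGroup E] (u : ℕ → E) {a b : ℕ} (h : a ≤ b) :
    ∑ i ∈ Ioc 0 b, u i - ∑ i ∈ Ioc 0 a, u i = ∑ i ∈ Ioc a b, u i := by
  rw [← sum_Ioc_consecutive u (Nat.zero_le a) h, add_sub_cancel_left]

theorem norm_sum_Ioc_le_of_partial {E : Type*} [NormedAddCommGroup E] {n : ℕ} {w : ℝ} (u : ℕ → E)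
    (hS : ∀ j ≤ n, ‖∑ i ∈ Ioc 0 j, u i‖ ≤ w) {a b : ℕ} (hab : a ≤ b) (hb : b ≤ n) :
    ‖∑ i ∈ Ioc a b, u i‖ ≤ 2 * w := by
  rw [← sum_Ioc_zero_sub u hab]
  refine (norm_sub_le _ _).trans ?_
  linarith [hS b hb, hS a (hab.trans hb)]

/-- Cauchy–Schwarz over the indices between `j` and `k`; the total energy stands in for the energy
of that stretch. -/
theorem sq_norm_partial_sub_le {E : Type*} [NormedAddCommGroup E] (u : ℕ → E) {n j k : ℕ} (hj : j ≤ n) (hk : k ≤ n) :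
    ‖∑ i ∈ Ioc 0 j, u i - ∑ i ∈ Ioc 0 k, u i‖ ^ 2
      ≤ |(j : ℝ) - k| * ∑ i ∈ Ioc 0 n, ‖u i‖ ^ 2 := by
  rcases le_total k j with h | h
  · rw [sum_Ioc_zero_sub u h, abs_of_nonneg (sub_nonneg.2 (Nat.cast_le.2 h)), ← Nat.cast_sub h]
    have := sq_norm_sum_le_card_mul (I := Ioc k j) (J := Ioc 0 n)
      (fun i hi => by simp only [Finset.mem_Ioc] at hi ⊢; omega) u
    rwa [Nat.card_Ioc] at this
  · rw [norm_sub_rev, sum_Ioc_zero_sub u h, abs_sub_comm,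
      abs_of_nonneg (sub_nonneg.2 (Nat.cast_le.2 h)), ← Nat.cast_sub h]
    have := sq_norm_sum_le_card_mul (I := Ioc j k) (J := Ioc 0 n)
      (fun i hi => by simp only [Finset.mem_Ioc] at hi ⊢; omega) u
    rwa [Nat.card_Ioc] at this

/-- The centred partial sum process of the CUSUM statistic. -/
noncomputable def cusum (n : ℕ) (x : ℕ → E) (k : ℕ) : E :=
  ∑ i ∈ Ioc 0 k, x i - ((k : ℝ) / n) • ∑ i ∈ Ioc 0 n, x i

/-- The coefficient of the change in the mean of the CUSUM process (up to sign). -/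
noncomputable def cusumCoeff (n k₀ k : ℕ) : ℝ := (k : ℝ) / n * (n - k₀) - ((k - k₀ : ℕ) : ℝ)

theorem sum_Ioc_change (d : E) (k₀ k : ℕ) :
    ∑ i ∈ Ioc 0 k, (if i ≤ k₀ then 0 else d) = ((k - k₀ : ℕ) : ℝ) • d := by
  simp_rw [← ite_not (_ ≤ k₀) d 0]
  rw [← sum_filter, sum_const, Nat.cast_smul_eq_nsmul]
  congr 1
  rw [← Nat.card_Ioc]
  congr 1
  ext i
  simp only [Finset.mem_filter, Finset.mem_Ioc]
  omega

/-- Centring kills the constant `c`, and the jump contributes a deterministic multiple of `d`. -/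
theorem cusum_eq {n k₀ : ℕ} (hn : 0 < n) (hk₀ : k₀ ≤ n) (x u : ℕ → E) (c d : E)
    (hx : ∀ i, x i = c + u i + if i ≤ k₀ then 0 else d) (k : ℕ) :
    cusum n x k = cusum n u k - cusumCoeff n k₀ k • d := by
  have hn' : (n : ℝ) ≠ 0 := by positivity
  have h : ∀ k, ∑ i ∈ Ioc 0 k, x i
      = (k : ℝ) • c + ∑ i ∈ Ioc 0 k, u i + ((k - k₀ : ℕ) : ℝ) • d := by
    intro k
    simp_rw [hx, sum_add_distrib, sum_Ioc_change]
    simp [Nat.cast_smul_eq_nsmul]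
  rw [cusum, cusum, h, h, cusumCoeff, smul_add, smul_add, smul_smul, smul_smul,
    div_mul_cancel₀ _ hn', Nat.cast_sub hk₀, sub_smul]
  abel

/-- With y = k₀ / n and z = k / n the coefficient is a tent: z (1 - y) n to the left of k₀ and y (1
- z) n to the right. Its slopes in `k` have absolute values 1 - y and y, both in [κ, 1], and its
peak is y (1 - y) n. -/
theorem cusumCoeff_bounds {n k₀ k : ℕ} {κ : ℝ} (hκ : 0 < κ) (hn : 0 < n) (hk : k ≤ n)
    (h1 : κ * n ≤ k₀) (h2 : κ * n ≤ n - k₀) :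
    κ * |(k : ℝ) - k₀| ≤ cusumCoeff n k₀ k₀ - cusumCoeff n k₀ k ∧
      cusumCoeff n k₀ k₀ - cusumCoeff n k₀ k ≤ |(k : ℝ) - k₀| ∧
      0 ≤ cusumCoeff n k₀ k ∧ cusumCoeff n k₀ k ≤ n ∧ κ ^ 2 * n ≤ cusumCoeff n k₀ k₀ := by
  have hn' : (0 : ℝ) < n := by positivity
  have hk' : (k : ℝ) ≤ n := Nat.cast_le.2 hk
  have hk0 : (0 : ℝ) ≤ k := Nat.cast_nonneg _
  have hx : ∃ y : ℝ, (k₀ : ℝ) = y * n ∧ κ ≤ y ∧ κ ≤ 1 - y := by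
    refine ⟨k₀ / n, by field_simp, by rwa [le_div_iff₀ hn'], ?_⟩
    rw [le_sub_comm, div_le_iff₀ hn']
    linarith
  obtain ⟨y, hy, hy1, hy2⟩ := hx
  have hz : ∃ z : ℝ, (k : ℝ) = z * n ∧ 0 ≤ z ∧ z ≤ 1 :=
    ⟨k / n, by field_simp, by positivity, by rwa [div_le_one hn']⟩
  obtain ⟨z, hz, hz1, hz2⟩ := hz
  have e0 : cusumCoeff n k₀ k₀ = y * (1 - y) * n := by
    rw [cusumCoeff, Nat.sub_self, Nat.cast_zero, hy]; field_simp; ring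
  rw [e0]
  have h5 : κ ^ 2 * n ≤ y * (1 - y) * n := by
    rw [sq]
    gcongr
    linarith
  rcases le_total k k₀ with h | h
  · have e1 : cusumCoeff n k₀ k = z * (1 - y) * n := by
      rw [cusumCoeff, Nat.sub_eq_zero_of_le h, Nat.cast_zero, hy, hz]; field_simp; ring
    have hzy : z ≤ y := by
      have : (k : ℝ) ≤ k₀ := Nat.cast_le.2 h
      rw [hy, hz] at this
      exact le_of_mul_le_mul_right this hn'
    rw [e1, abs_of_nonpos (by rw [hy, hz]; nlinarith), hy, hz]
    have : 0 ≤ (y - z) * n := by nlinarith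
    refine ⟨by nlinarith, by nlinarith, ?_, ?_, h5⟩
    · have : 0 ≤ 1 - y := by linarith
      positivity
    · have : z * (1 - y) ≤ 1 := by nlinarith
      nlinarith
  · have e1 : cusumCoeff n k₀ k = y * (1 - z) * n := by
      rw [cusumCoeff, Nat.cast_sub h, hy, hz]; field_simp; ring
    have hzy : y ≤ z := by
      have : (k₀ : ℝ) ≤ k := Nat.cast_le.2 h
      rw [hy, hz] at this
      exact le_of_mul_le_mul_right this hn'
    rw [e1, abs_of_nonneg (by rw [hy, hz]; nlinarith), hy, hz]
    have : 0 ≤ (z - y) * n := by nlinarith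
    refine ⟨by nlinarith, by nlinarith, ?_, ?_, h5⟩
    · have : 0 ≤ 1 - z := by linarith
      have : 0 ≤ y := by linarith
      positivity
    · have : y * (1 - z) ≤ 1 := by nlinarith
      nlinarith

/-- If the noise is small, a maximizer of the CUSUM objective function is close to the change. -/
theorem abs_sub_le_of_norm_cusum_le {n k₀ k : ℕ} {κ γ θ ξ M : ℝ} (hκ : 0 < κ) (hn : 0 < n)
    (hk : k ≤ n) (hk₀ : k₀ ≤ n) (h1 : κ * n ≤ k₀) (h2 : κ * n ≤ n - k₀)
    (hγ0 : 0 ≤ γ) (hγ1 : γ ≤ 1) (hθ0 : 0 < θ) (hθ1 : θ ≤ 1) (hM : 1 ≤ M)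
    (hξ0 : 0 ≤ ξ) (hξ1 : ξ ≤ 1) (hξ : 16 * ξ * M < κ ^ 3 * θ)
    (x u : ℕ → E) (c d : E) (hd : 0 < ‖d‖)
    (hx : ∀ i, x i = c + u i + if i ≤ k₀ then 0 else d)
    (hA : ∑ i ∈ Ioc 0 n, ‖u i‖ ^ 2 ≤ M * n * γ * ‖d‖ ^ 2)
    (hS : ∀ j ≤ n, ‖∑ i ∈ Ioc 0 j, u i‖ ≤ ξ * n * (√γ * ‖d‖))
    (hL : θ ^ 2 * n * γ < |(k : ℝ) - k₀| * M →
      |⟪d, ∑ i ∈ Ioc 0 k, u i - ∑ i ∈ Ioc 0 k₀, u i⟫| ≤ ξ * |(k : ℝ) - k₀| * ‖d‖ ^ 2)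
    (hmax : ‖cusum n x k₀‖ ≤ ‖cusum n x k‖) :
    |(k : ℝ) - k₀| * M ≤ θ ^ 2 * n * γ := by
  by_contra! hlt
  replace hL := hL hlt
  obtain ⟨c1, c2, c3, c4, c5⟩ := cusumCoeff_bounds hκ hn hk h1 h2
  obtain ⟨-, -, -, c6, -⟩ := cusumCoeff_bounds hκ hn hk₀ h1 h2
  rw [cusum_eq hn hk₀ x u c d hx, cusum_eq hn hk₀ x u c d hx] at hmax
  set ℓ : ℝ := |(k : ℝ) - k₀| with hℓ
  set e := cusumCoeff n k₀ k
  set e₀ := cusumCoeff n k₀ k₀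
  set t := ‖d‖
  have hn' : (0 : ℝ) < n := by positivity
  have hs0 : 0 ≤ √γ := Real.sqrt_nonneg _
  have hs1 : √γ ≤ 1 := Real.sqrt_le_one.2 hγ1
  have hℓ0 : 0 < ℓ := by
    have : 0 ≤ θ ^ 2 * n * γ := by positivity
    by_contra h
    nlinarith
  have hw : ∀ j ≤ n, ‖∑ i ∈ Ioc 0 j, u i‖ ≤ ξ * n * t := fun j hj => by
    refine (hS j hj).trans ?_
    gcongr
    nlinarith
  have hW : ∀ j ≤ n, ‖cusum n u j‖ ≤ 2 * (ξ * n * t) := fun j hj => by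
    have hj' : (j : ℝ) / n ≤ 1 := by rw [div_le_one hn']; exact_mod_cast hj
    refine (norm_sub_le _ _).trans ?_
    rw [norm_smul, Real.norm_of_nonneg (by positivity)]
    have h3 := hw j hj
    have h4 := hw n le_rfl
    have : (j : ℝ) / n * ‖∑ i ∈ Ioc 0 n, u i‖ ≤ 1 * (ξ * n * t) := by gcongr
    linarith
  have hdiff : cusum n u k - cusum n u k₀ = (∑ i ∈ Ioc 0 k, u i - ∑ i ∈ Ioc 0 k₀, u i)
      - (((k : ℝ) - k₀) / n) • ∑ i ∈ Ioc 0 n, u i := by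
    rw [cusum, cusum, sub_div, sub_smul]; abel
  -- The energy alone gives a bound of order √ℓ. The assumption `θ ^ 2 * n * γ < ℓ * M`, made for
  -- contradiction, turns it into one linear in `ℓ`.
  have hSS : ‖∑ i ∈ Ioc 0 k, u i - ∑ i ∈ Ioc 0 k₀, u i‖ ≤ M / θ * ℓ * t := by
    refine (sq_le_sq₀ (norm_nonneg _) (by positivity)).1 ?_
    calc _ ≤ ℓ * (M * n * γ * t ^ 2) :=
          (sq_norm_partial_sub_le u hk hk₀).trans (by gcongr)
      _ = M * ℓ * t ^ 2 * (θ ^ 2 * n * γ) / θ ^ 2 := by field_simp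
      _ ≤ M * ℓ * t ^ 2 * (ℓ * M) / θ ^ 2 := by gcongr
      _ = _ := by ring
  have hWW : ‖cusum n u k - cusum n u k₀‖ ≤ (M / θ + ξ) * ℓ * t := by
    rw [hdiff]
    refine (norm_sub_le _ _).trans ?_
    rw [norm_smul, Real.norm_eq_abs, abs_div, ← hℓ, abs_of_pos hn']
    have : ℓ / n * ‖∑ i ∈ Ioc 0 n, u i‖ ≤ ℓ / n * (ξ * n * t) := by
      gcongr; exact hw n le_rfl
    have h5 : ℓ / n * (ξ * n * t) = ξ * ℓ * t := by field_simp
    linarith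
  have hi0 : |⟪d, cusum n u k₀⟫| ≤ 2 * ξ * n * t ^ 2 := by
    refine (abs_real_inner_le_norm _ _).trans ?_
    have := mul_le_mul_of_nonneg_left (hW k₀ hk₀) hd.le
    linarith
  have hii : |⟪d, cusum n u k - cusum n u k₀⟫| ≤ 2 * ξ * ℓ * t ^ 2 := by
    rw [hdiff, inner_sub_right, inner_smul_right]
    refine (abs_sub _ _).trans ?_
    rw [abs_mul, abs_div, ← hℓ, abs_of_pos hn']
    have h3 : |⟪d, ∑ i ∈ Ioc 0 n, u i⟫| ≤ t * (ξ * n * t) :=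
      (abs_real_inner_le_norm _ _).trans (by gcongr; exact hw n le_rfl)
    have h4 : ℓ / n * |⟪d, ∑ i ∈ Ioc 0 n, u i⟫| ≤ ℓ / n * (t * (ξ * n * t)) := by gcongr
    have h5 : ℓ / n * (t * (ξ * n * t)) = ξ * ℓ * t ^ 2 := by field_simp
    linarith
  -- Expanding both squares bounds (e₀² - e²) t² by three noise differences, each carrying a factor
  -- `ℓ` and a factor `ξ`. The left side is at least κ³ n ℓ t² by the slope and the peak of the
  -- tent, so a small `ξ` is contradictory.
  have hsq := pow_le_pow_left₀ (norm_nonneg _) hmax 2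
  rw [norm_sub_sq_real, norm_sub_sq_real, inner_smul_right, inner_smul_right, norm_smul,
    norm_smul, mul_pow, mul_pow, Real.norm_eq_abs, Real.norm_eq_abs, sq_abs, sq_abs,
    real_inner_comm d, real_inner_comm d] at hsq
  have hterm1 : ‖cusum n u k‖ ^ 2 - ‖cusum n u k₀‖ ^ 2
      ≤ (M / θ + ξ) * ℓ * t * (4 * (ξ * n * t)) := by
    have h3 := abs_norm_sub_norm_le (cusum n u k) (cusum n u k₀)
    have h4 := (le_abs_self _).trans (h3.trans hWW)
    have h5 := hW k hk
    have h6 := hW k₀ hk₀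
    have h7 := norm_nonneg (cusum n u k)
    have h8 := norm_nonneg (cusum n u k₀)
    calc _ = (‖cusum n u k‖ - ‖cusum n u k₀‖) * (‖cusum n u k‖ + ‖cusum n u k₀‖) := by ring
      _ ≤ (M / θ + ξ) * ℓ * t * (‖cusum n u k‖ + ‖cusum n u k₀‖) := by gcongr
      _ ≤ _ := by gcongr; linarith
  have hterm2 : -2 * e * ⟪d, cusum n u k - cusum n u k₀⟫ ≤ 2 * n * (2 * ξ * ℓ * t ^ 2) := by
    calc _ = 2 * e * -⟪d, cusum n u k - cusum n u k₀⟫ := by ring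
      _ ≤ 2 * e * (2 * ξ * ℓ * t ^ 2) := by
          gcongr; exact (neg_le_abs _).trans hii
      _ ≤ _ := by gcongr
  have hterm3 : 2 * (e₀ - e) * ⟪d, cusum n u k₀⟫ ≤ 2 * ℓ * (2 * ξ * n * t ^ 2) := by
    have : 0 ≤ e₀ - e := le_trans (by positivity) c1
    calc _ ≤ 2 * (e₀ - e) * (2 * ξ * n * t ^ 2) := by
          gcongr; exact (le_abs_self _).trans hi0
      _ ≤ _ := by gcongr
  have hmain : κ ^ 3 * n * ℓ * t ^ 2 ≤ (e₀ - e) * (e₀ + e) * t ^ 2 := by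
    have h3 : κ * ℓ * (κ ^ 2 * n) ≤ (e₀ - e) * (e₀ + e) := by
      gcongr
      · exact le_trans (by positivity) c1
      · linarith
    calc _ = κ * ℓ * (κ ^ 2 * n) * t ^ 2 := by ring
      _ ≤ _ := by gcongr
  rw [inner_sub_right] at hterm2
  have htot : κ ^ 3 * n * ℓ * t ^ 2 ≤ (8 + 4 * (M / θ) + 4 * ξ) * ξ * (n * ℓ * t ^ 2) := by
    linarith
  have hpos : 0 < n * ℓ * t ^ 2 := by positivity
  have hκξ : κ ^ 3 ≤ (8 + 4 * (M / θ) + 4 * ξ) * ξ := by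
    refine le_of_mul_le_mul_right ?_ hpos
    linarith
  have hMθ : 1 ≤ M / θ := by rw [one_le_div hθ0]; linarith
  -- Since `M / θ ≥ 1` and `ξ ≤ 1`, the bracket is at most (8 + 4 + 4) M / θ.
  have : (8 + 4 * (M / θ) + 4 * ξ) * ξ ≤ 16 * (M / θ) * ξ := by gcongr; linarith
  have h9 : κ ^ 3 * θ ≤ 16 * (M / θ) * ξ * θ := by gcongr; linarith
  have h10 : 16 * (M / θ) * ξ * θ = 16 * ξ * M := by field_simp
  linarith

/-! ### Pathwise bounds for the test statistic -/

/-- Cauchy–Schwarz in the index and in `E`. The factor `#I` is the gain that makes short windows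
cheap. -/
theorem sq_sum_abs_inner_le {I : Finset ℕ} {n : ℕ} (hI : I ⊆ Ioc 0 n) (d : E) (u : ℕ → E) :
    (∑ i ∈ I, |⟪d, u i⟫|) ^ 2 ≤ #I * (‖d‖ ^ 2 * ∑ i ∈ Ioc 0 n, ‖u i‖ ^ 2) := by
  refine sq_sum_le_card_mul_sum_sq.trans ?_
  gcongr
  rw [mul_sum]
  refine (sum_le_sum_of_subset_of_nonneg hI fun i _ _ => by positivity).trans
    (sum_le_sum fun i _ => ?_)
  rw [← mul_pow]
  exact pow_le_pow_left₀ (abs_nonneg _) (abs_real_inner_le_norm _ _) 2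

/-- Moving the index interval in the linear part of the statistic. -/
theorem abs_inner_pairSum_sub_le (m n : ℕ) {a b a' b' : ℕ} (hb : b ≤ n) (hb' : b' ≤ n)
    (W : Finset ℕ) (hWn : W ⊆ Ioc 0 n)
    (hW : ∀ i, i ∉ W → (i ∈ Ioc a b ↔ i ∈ Ioc a' b')) (d : E) (u : ℕ → E) {τ : ℝ}
    (hτ : 0 ≤ τ) (h : #W * (‖d‖ ^ 2 * ∑ i ∈ Ioc 0 n, ‖u i‖ ^ 2) ≤ τ ^ 2) :
    |⟪d, pairSum m a b u⟫ - ⟪d, pairSum m a' b' u⟫| ≤ 2 * n * τ := by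
  rw [inner_pairSum, inner_pairSum]
  have hWc : (#W : ℝ) ≤ n := by
    have := card_le_card hWn
    rw [Nat.card_Ioc, Nat.sub_zero] at this
    exact_mod_cast this
  have h1 : ∑ i ∈ W, |⟪d, u i⟫| ≤ τ :=
    (sq_le_sq₀ (sum_nonneg fun _ _ => abs_nonneg _) hτ).1 ((sq_sum_abs_inner_le hWn d u).trans h)
  have h2 : #W * ∑ i ∈ Ioc 0 n, |⟪d, u i⟫| ≤ n * τ := by
    refine (sq_le_sq₀ (by positivity) (by positivity)).1 ?_
    have h3 := sq_sum_abs_inner_le (Finset.Subset.refl (Ioc 0 n)) d u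
    rw [Nat.card_Ioc, Nat.sub_zero] at h3
    calc _ = (#W : ℝ) ^ 2 * (∑ i ∈ Ioc 0 n, |⟪d, u i⟫|) ^ 2 := by ring
      _ ≤ (#W : ℝ) ^ 2 * (n * (‖d‖ ^ 2 * ∑ i ∈ Ioc 0 n, ‖u i‖ ^ 2)) := by gcongr
      _ = #W * n * (#W * (‖d‖ ^ 2 * ∑ i ∈ Ioc 0 n, ‖u i‖ ^ 2)) := by ring
      _ ≤ n * n * τ ^ 2 := by gcongr
      _ = _ := by ring
  refine (abs_pairSum_sub_pairSum_le m n hb hb' _ W hWn hW).trans ?_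
  have : (n : ℝ) * ∑ i ∈ W, |⟪d, u i⟫| ≤ n * τ := by gcongr
  linarith

/-- The sign of the change of regime of index `i` when the change point `k₀` is replaced by `k`. -/
noncomputable def regimeShift (k₀ k i : ℕ) : ℝ := (if k₀ < i then 1 else 0) - if k < i then 1 else 0

theorem abs_regimeShift (k₀ k i : ℕ) :
    |regimeShift k₀ k i| = if i ∈ Ioc (min k k₀) (max k k₀) then 1 else 0 := by
  simp only [regimeShift, Finset.mem_Ioc, min_lt_iff, le_max_iff]
  split_ifs <;> simp <;> omega

theorem sum_abs_regimeShift_le {k₀ k R : ℕ} (h1 : k ≤ k₀ + R) (h2 : k₀ ≤ k + R)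
    (I : Finset ℕ) : ∑ i ∈ I, |regimeShift k₀ k i| ≤ R := by
  simp_rw [abs_regimeShift]
  rw [← sum_filter, sum_const, nsmul_one]
  have : #(I.filter fun i => i ∈ Ioc (min k k₀) (max k k₀)) ≤ #(Ioc (min k k₀) (max k k₀)) :=
    card_le_card fun i hi => (Finset.mem_filter.1 hi).2
  rw [Nat.card_Ioc] at this
  exact_mod_cast this.trans (by omega)

/-! ### Noise relabelled by the estimated change point. -/

section

variable {n m k₀ k R : ℕ} {γ θ M : ℝ} {u v : ℕ → E} {d : E}

/-- Two parts of the constant 3 come from a difference of partial sums. The third is the shift: at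
most `R` indices change regime, and γ ≤ √γ, θ² ≤ θ. -/
theorem norm_sum_shifted_le (hγ0 : 0 ≤ γ) (hγ1 : γ ≤ 1) (hθ0 : 0 ≤ θ) (hθ1 : θ ≤ 1)
    (h1 : k ≤ k₀ + R) (h2 : k₀ ≤ k + R) (hR : R ≤ θ ^ 2 * n * γ)
    (hS : ∀ j ≤ n, ‖∑ i ∈ Ioc 0 j, u i‖ ≤ θ * n * (√γ * ‖d‖))
    (hv : ∀ i, v i = u i + regimeShift k₀ k i • d) {a b : ℕ} (hab : a ≤ b) (hb : b ≤ n) :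
    ‖∑ i ∈ Ioc a b, v i‖ ≤ 3 * θ * n * (√γ * ‖d‖) := by
  simp_rw [hv, sum_add_distrib]
  refine (norm_add_le _ _).trans ?_
  have h3 := norm_sum_Ioc_le_of_partial u hS hab hb
  have h4 : ‖∑ i ∈ Ioc a b, regimeShift k₀ k i • d‖ ≤ R * ‖d‖ := by
    refine (norm_sum_le _ _).trans ?_
    simp_rw [norm_smul, ← sum_mul, Real.norm_eq_abs]
    gcongr
    exact sum_abs_regimeShift_le h1 h2 _
  have hs : γ ≤ √γ := Real.le_sqrt_of_sq_le (by nlinarith)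
  have h5 : (R : ℝ) * ‖d‖ ≤ θ * n * √γ * ‖d‖ := by
    gcongr
    refine hR.trans ?_
    gcongr
    nlinarith
  linarith

theorem sum_sq_norm_shifted_le (hγ0 : 0 ≤ γ) (hθ0 : 0 ≤ θ) (hθ1 : θ ≤ 1) (hM : 1 ≤ M)
    (h1 : k ≤ k₀ + R) (h2 : k₀ ≤ k + R) (hR : R ≤ θ ^ 2 * n * γ)
    (hA : ∑ i ∈ Ioc 0 n, ‖u i‖ ^ 2 ≤ M * n * γ * ‖d‖ ^ 2)
    (hv : ∀ i, v i = u i + regimeShift k₀ k i • d) :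
    ∑ i ∈ Ioc 0 n, ‖v i‖ ^ 2 ≤ 4 * M * n * (γ * ‖d‖ ^ 2) := by
  have h3 : ∀ i, ‖v i‖ ^ 2 ≤ 2 * ‖u i‖ ^ 2 + 2 * ‖d‖ ^ 2 * |regimeShift k₀ k i| := fun i => by
    have h4 : ‖v i‖ ^ 2 ≤ (‖u i‖ + |regimeShift k₀ k i| * ‖d‖) ^ 2 := by
      rw [hv]
      gcongr
      refine (norm_add_le _ _).trans ?_
      rw [norm_smul, Real.norm_eq_abs]
    have h5 : |regimeShift k₀ k i| ^ 2 = |regimeShift k₀ k i| := by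
      rw [abs_regimeShift]; split_ifs <;> simp
    calc _ ≤ _ := h4
      _ ≤ 2 * ‖u i‖ ^ 2 + 2 * ‖d‖ ^ 2 * |regimeShift k₀ k i| ^ 2 := by
          nlinarith [sq_nonneg (‖u i‖ - |regimeShift k₀ k i| * ‖d‖)]
      _ = _ := by rw [h5]
  refine (sum_le_sum fun i _ => h3 i).trans ?_
  rw [sum_add_distrib, ← mul_sum, ← mul_sum]
  have h6 := sum_abs_regimeShift_le h1 h2 (Ioc 0 n)
  have h7 : 2 * ‖d‖ ^ 2 * ∑ i ∈ Ioc 0 n, |regimeShift k₀ k i| ≤ 2 * ‖d‖ ^ 2 * (M * n * γ) := by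
    gcongr
    refine h6.trans (hR.trans ?_)
    gcongr
    nlinarith
  linarith

theorem abs_pairForm_shifted_le (hγ0 : 0 ≤ γ) (hθ0 : 0 ≤ θ) (hθ1 : θ ≤ 1)
    (hm : (2 * m + 1) * (4 * M) ≤ θ * n) {a b : ℕ} (hb : b ≤ n)
    (hS : ‖∑ i ∈ Ioc a b, v i‖ ≤ 3 * θ * n * (√γ * ‖d‖))
    (hA : ∑ i ∈ Ioc 0 n, ‖v i‖ ^ 2 ≤ 4 * M * n * (γ * ‖d‖ ^ 2)) :
    |pairForm m a b v| ≤ 10 * θ * n ^ 2 * (γ * ‖d‖ ^ 2) := by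
  refine (abs_pairForm_le m a b v).trans ?_
  have h1 : ‖∑ i ∈ Ioc a b, v i‖ ^ 2 ≤ 9 * θ * n ^ 2 * (γ * ‖d‖ ^ 2) := by
    calc _ ≤ (3 * θ * n * (√γ * ‖d‖)) ^ 2 := by gcongr
      _ = 9 * (θ * θ) * n ^ 2 * (√γ ^ 2 * ‖d‖ ^ 2) := by ring
      _ ≤ _ := by
          rw [Real.sq_sqrt hγ0]
          gcongr
          nlinarith
  have h2 : (2 * m + 1) * ∑ i ∈ Ioc a b, ‖v i‖ ^ 2 ≤ θ * n ^ 2 * (γ * ‖d‖ ^ 2) := by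
    calc _ ≤ (2 * m + 1) * (4 * M * n * (γ * ‖d‖ ^ 2)) := by
          gcongr
          refine (sum_le_sum_of_subset_of_nonneg (fun i hi => ?_) fun _ _ _ => by positivity).trans hA
          simp only [Finset.mem_Ioc] at hi ⊢
          omega
      _ = (2 * m + 1) * (4 * M) * (n * (γ * ‖d‖ ^ 2)) := by ring
      _ ≤ θ * n * (n * (γ * ‖d‖ ^ 2)) := by gcongr
      _ = _ := by ring
  linarith

/-- The full sum gives 3θ. The near-diagonal correction is an ℓ¹ norm, bounded through the energy by
Cauchy–Schwarz and made small by m = o(n). -/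
theorem norm_pairSum_shifted_le (hγ0 : 0 ≤ γ) (hθ0 : 0 ≤ θ) (hM : 1 ≤ M)
    (hm : (2 * m + 1) * (4 * M) ≤ θ * n) {a b : ℕ} (hb : b ≤ n)
    (hS : ‖∑ i ∈ Ioc a b, v i‖ ≤ 3 * θ * n * (√γ * ‖d‖))
    (hA : ∑ i ∈ Ioc 0 n, ‖v i‖ ^ 2 ≤ 4 * M * n * (γ * ‖d‖ ^ 2)) :
    ‖pairSum m a b v‖ ≤ 4 * θ * n ^ 2 * (√γ * ‖d‖) := by
  refine (norm_pairSum_le m a b v).trans ?_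
  have h1 : ((b - a : ℕ) : ℝ) * ‖∑ i ∈ Ioc a b, v i‖ ≤ n * (3 * θ * n * (√γ * ‖d‖)) := by
    gcongr
    omega
  have hsub : Ioc a b ⊆ Ioc 0 n := fun i hi => by
    simp only [Finset.mem_Ioc] at hi ⊢
    omega
  have h2 : ∑ i ∈ Ioc a b, ‖v i‖ ≤ 2 * M * n * (√γ * ‖d‖) := by
    refine (sum_le_sum_of_subset_of_nonneg hsub fun _ _ _ => norm_nonneg _).trans ?_
    refine (sq_le_sq₀ (by positivity) (by positivity)).1 ?_
    refine sq_sum_le_card_mul_sum_sq.trans ?_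
    rw [Nat.card_Ioc, Nat.sub_zero]
    calc _ ≤ n * (4 * M * n * (γ * ‖d‖ ^ 2)) := by gcongr
      _ ≤ n * (4 * (M * M) * n * (γ * ‖d‖ ^ 2)) := by gcongr; nlinarith
      _ = (2 * M * n) ^ 2 * (γ * ‖d‖ ^ 2) := by ring
      _ = (2 * M * n) ^ 2 * (√γ ^ 2 * ‖d‖ ^ 2) := by rw [Real.sq_sqrt hγ0]
      _ = _ := by ring
  have h3 : (2 * m + 1) * ∑ i ∈ Ioc a b, ‖v i‖ ≤ θ * n ^ 2 * (√γ * ‖d‖) := by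
    calc _ ≤ (2 * m + 1) * (2 * M * n * (√γ * ‖d‖)) := by gcongr
      _ = (2 * m + 1) * (4 * M) * (n * (√γ * ‖d‖) / 2) := by ring
      _ ≤ θ * n * (n * (√γ * ‖d‖) / 2) := by gcongr
      _ ≤ θ * n * (n * (√γ * ‖d‖)) := by
          gcongr
          exact half_le_self (by positivity)
      _ = _ := by ring
  linarith

/-- Bounding this term by the norm of `pairSum` would leave √γ in place of γ, which is too weak for
small γ. Instead the window is moved to the true change, where the linear form has deterministic
indices and its variance can be computed. The window `W` costs √(3 R M n γ) ‖d‖², which is of order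
γ because of `R * M ≤ θ ^ 2 * n * γ`. -/
theorem abs_inner_pairSum_shifted_le (hγ0 : 0 ≤ γ) (hθ0 : 0 ≤ θ) (hθ1 : θ ≤ 1) (hM : 1 ≤ M)
    (h1 : k ≤ k₀ + R) (h2 : k₀ ≤ k + R) (hR : R * M ≤ θ ^ 2 * n * γ)
    (hA : ∑ i ∈ Ioc 0 n, ‖u i‖ ^ 2 ≤ M * n * γ * ‖d‖ ^ 2)
    (hv : ∀ i, v i = u i + regimeShift k₀ k i • d)
    {a b a' b' : ℕ} (hb : b ≤ n) (hb' : b' ≤ n)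
    (W : Finset ℕ) (hWn : W ⊆ Ioc 0 n) (hWR : #W ≤ 3 * R)
    (hW : ∀ i, i ∉ W → (i ∈ Ioc a b ↔ i ∈ Ioc a' b')) :
    |⟪d, pairSum m a b v⟫| ≤ |⟪d, pairSum m a' b' u⟫| + 5 * θ * n ^ 2 * (γ * ‖d‖ ^ 2) := by
  have e1 : ⟪d, pairSum m a b v⟫
      = ⟪d, pairSum m a b u⟫ + pairSum m a b (regimeShift k₀ k) * ‖d‖ ^ 2 := by
    rw [inner_pairSum, inner_pairSum, pairSum, pairSum, pairSum, sum_mul, ← sum_add_distrib]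
    refine sum_congr rfl fun i _ => ?_
    rw [hv, inner_add_right, inner_smul_right, real_inner_self_eq_norm_sq]
  have e2 : |pairSum m a b (regimeShift k₀ k) * ‖d‖ ^ 2| ≤ θ * n ^ 2 * (γ * ‖d‖ ^ 2) := by
    rw [abs_mul, abs_of_nonneg (sq_nonneg ‖d‖)]
    have h3 := abs_pairSum_le m a b (regimeShift k₀ k)
    have h4 := sum_abs_regimeShift_le h1 h2 (Ioc a b)
    have h5 : ((b - a : ℕ) : ℝ) ≤ n := by
      have : b - a ≤ n := by omega
      exact_mod_cast this
    have h6 : (R : ℝ) ≤ θ * n * γ := by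
      calc (R : ℝ) ≤ R * M := le_mul_of_one_le_right (by positivity) hM
        _ ≤ _ := hR
        _ ≤ _ := by gcongr; nlinarith
    calc _ ≤ ((b - a : ℕ) : ℝ) * (∑ i ∈ Ioc a b, |regimeShift k₀ k i|) * ‖d‖ ^ 2 := by gcongr
      _ ≤ n * (θ * n * γ) * ‖d‖ ^ 2 := by
          have := h4.trans h6
          gcongr
      _ = _ := by ring
  have e3 : |⟪d, pairSum m a b u⟫ - ⟪d, pairSum m a' b' u⟫| ≤ 2 * n * (2 * (θ * n * γ * ‖d‖ ^ 2)) := by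
    refine abs_inner_pairSum_sub_le m n hb hb' W hWn hW d u (by positivity) ?_
    calc _ ≤ (3 * R : ℝ) * (‖d‖ ^ 2 * (M * n * γ * ‖d‖ ^ 2)) := by
          gcongr
          exact_mod_cast hWR
      _ = 3 * (R * M) * (n * γ * ‖d‖ ^ 4) := by ring
      _ ≤ 3 * (θ ^ 2 * n * γ) * (n * γ * ‖d‖ ^ 4) := by gcongr
      _ ≤ 4 * (θ ^ 2 * n * γ) * (n * γ * ‖d‖ ^ 4) := by gcongr; norm_num
      _ = _ := by ring
  rw [e1]
  have h7 := abs_add_le ⟪d, pairSum m a b u⟫ (pairSum m a b (regimeShift k₀ k) * ‖d‖ ^ 2)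
  have h8 := abs_sub_abs_le_abs_sub ⟪d, pairSum m a b u⟫ ⟪d, pairSum m a' b' u⟫
  linarith

/-- The quadruple sum is close to its mean part, up to the linear noise terms at the true change. -/
theorem abs_quadSum_sub_le (hγ0 : 0 ≤ γ) (hγ1 : γ ≤ 1) (hθ0 : 0 ≤ θ) (hθ1 : θ ≤ 1) (hM : 1 ≤ M)
    (hm : (2 * m + 1) * (4 * M) ≤ θ * n)
    {a a₀ b b₀ : ℕ} (hak : a ≤ k) (hb : k + b ≤ n) (hak₀ : a₀ ≤ k₀) (hb₀ : k₀ + b₀ ≤ n)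
    (h1 : k ≤ k₀ + R) (h2 : k₀ ≤ k + R) (h3 : a ≤ a₀ + R) (h4 : a₀ ≤ a + R)
    (h5 : b ≤ b₀ + R) (h6 : b₀ ≤ b + R) (hR : R * M ≤ θ ^ 2 * n * γ)
    (hA : ∑ i ∈ Ioc 0 n, ‖u i‖ ^ 2 ≤ M * n * γ * ‖d‖ ^ 2)
    (hS : ∀ j ≤ n, ‖∑ i ∈ Ioc 0 j, u i‖ ≤ θ * n * (√γ * ‖d‖))
    {x : ℕ → E} (hx : ∀ i, x i = u i + if i ≤ k₀ then 0 else d) :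
    |quadSum m a k b x - numPairs m a * numPairs m b * ‖d‖ ^ 2|
      ≤ 72 * θ * n ^ 4 * (γ * ‖d‖ ^ 2)
        + 2 * n ^ 2 * (|⟪d, pairSum m 0 a₀ u⟫| + |⟪d, pairSum m k₀ (k₀ + b₀) u⟫|) := by
  classical
  set v : ℕ → E := fun i => u i + regimeShift k₀ k i • d with hvdef
  have hv : ∀ i, v i = u i + regimeShift k₀ k i • d := fun i => rfl
  have hR' : (R : ℝ) ≤ θ ^ 2 * n * γ := (le_mul_of_one_le_right (by positivity) hM).trans hR
  have hxl : ∀ i ≤ k, x i = v i := fun i hi => by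
    rw [hx, hv, regimeShift]
    split_ifs <;> first | omega | simp
  have hxr : ∀ i, k < i → x i = v i + d := fun i hi => by
    rw [hx, hv, regimeShift]
    split_ifs <;> first | omega | simp
  have hAv := sum_sq_norm_shifted_le hγ0 hθ0 hθ1 hM h1 h2 hR' hA hv
  have hS1 := norm_sum_shifted_le hγ0 hγ1 hθ0 hθ1 h1 h2 hR' hS hv (Nat.zero_le a) (by omega)
  have hS2 := norm_sum_shifted_le hγ0 hγ1 hθ0 hθ1 h1 h2 hR' hS hv (Nat.le_add_right k b) hb
  have q1 := abs_pairForm_shifted_le (a := 0) (b := a) hγ0 hθ0 hθ1 hm (by omega) hS1 hAv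
  have q2 := abs_pairForm_shifted_le hγ0 hθ0 hθ1 hm hb hS2 hAv
  have l1 := norm_pairSum_shifted_le (a := 0) (b := a) hγ0 hθ0 hM hm (by omega) hS1 hAv
  have l2 := norm_pairSum_shifted_le hγ0 hθ0 hM hm hb hS2 hAv
  have d1 := abs_inner_pairSum_shifted_le (m := m) hγ0 hθ0 hθ1 hM h1 h2 hR hA hv
    (a := 0) (b := a) (a' := 0) (b' := a₀) (by omega) (by omega) (Ioc (min a a₀) (max a a₀))
    (fun i hi => by simp only [Finset.mem_Ioc] at hi ⊢; omega)
    (by rw [Nat.card_Ioc]; omega)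
    (fun i hi => by simp only [Finset.mem_Ioc] at hi ⊢; omega)
  -- The left end moves by at most `R`; the right end by at most `2 * R`, since both `k` and `b`
  -- move. This is the source of `3 * R`.
  have d2 := abs_inner_pairSum_shifted_le (m := m) hγ0 hθ0 hθ1 hM h1 h2 hR hA hv
    (a := k) (b := k + b) (a' := k₀) (b' := k₀ + b₀) hb hb₀
    (Ioc (min k k₀) (max k k₀) ∪ Ioc (min (k + b) (k₀ + b₀)) (max (k + b) (k₀ + b₀)))
    (fun i hi => by simp only [Finset.mem_union, Finset.mem_Ioc] at hi ⊢; omega)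
    ((card_union_le _ _).trans (by rw [Nat.card_Ioc, Nat.card_Ioc]; omega))
    (fun i hi => by simp only [Finset.mem_union, Finset.mem_Ioc] at hi ⊢; omega)
  have hn0 : (0 : ℝ) ≤ n := Nat.cast_nonneg n
  have hNle : ∀ j ≤ n, numPairs m j ≤ (n : ℝ) ^ 2 := fun j hj =>
    (numPairs_le_sq m j).trans (by gcongr)
  have hNa := hNle a (by omega)
  have hNb := hNle b (by omega)
  have hNa0 := numPairs_nonneg m a
  have hNb0 := numPairs_nonneg m b
  have t1 : |numPairs m b * pairForm m 0 a v| ≤ n ^ 2 * (10 * θ * n ^ 2 * (γ * ‖d‖ ^ 2)) := by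
    rw [abs_mul, abs_of_nonneg hNb0]; gcongr
  have t2 : |numPairs m a * pairForm m k (k + b) v|
      ≤ n ^ 2 * (10 * θ * n ^ 2 * (γ * ‖d‖ ^ 2)) := by
    rw [abs_mul, abs_of_nonneg hNa0]; gcongr
  have t3 : |⟪pairSum m 0 a v, pairSum m k (k + b) v⟫| ≤ 16 * θ * n ^ 4 * (γ * ‖d‖ ^ 2) := by
    refine (abs_real_inner_le_norm _ _).trans ?_
    calc _ ≤ (4 * θ * n ^ 2 * (√γ * ‖d‖)) * (4 * θ * n ^ 2 * (√γ * ‖d‖)) := by gcongr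
      _ = 16 * (θ * θ) * n ^ 4 * (√γ ^ 2 * ‖d‖ ^ 2) := by ring
      _ ≤ _ := by
          rw [Real.sq_sqrt hγ0]
          gcongr
          nlinarith
  have t4 : |numPairs m b * ⟪d, pairSum m 0 a v⟫|
      ≤ n ^ 2 * (|⟪d, pairSum m 0 a₀ u⟫| + 5 * θ * n ^ 2 * (γ * ‖d‖ ^ 2)) := by
    rw [abs_mul, abs_of_nonneg hNb0]; gcongr
  have t5 : |numPairs m a * ⟪d, pairSum m k (k + b) v⟫|
      ≤ n ^ 2 * (|⟪d, pairSum m k₀ (k₀ + b₀) u⟫| + 5 * θ * n ^ 2 * (γ * ‖d‖ ^ 2)) := by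
    rw [abs_mul, abs_of_nonneg hNa0]; gcongr
  -- The constant is 72 = 10 + 10 + 2 · 16 + 2 · 5 + 2 · 5, one summand for each noise term of the
  -- expansion.
  rw [quadSum_eq m hak x v d hxl hxr, add_sub_cancel_right]
  rw [abs_le] at t1 t2 t3 t4 t5 ⊢
  constructor <;> linarith [t1.1, t1.2, t2.1, t2.2, t3.1, t3.2, t4.1, t4.2, t5.1, t5.2]

end

end InnerProduct

/-! ### The statistics as functions on Euclidean space -/

theorem inner_toLp_eq_dotProduct {p : ℕ} (x y : Fin p → ℝ) :
    ⟪WithLp.toLp 2 x, WithLp.toLp 2 y⟫ = x ⬝ᵥ y := by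
  rw [EuclideanSpace.inner_toLp_toLp]
  simp [dotProduct_comm]

theorem norm_toLp_sq {p : ℕ} (x : Fin p → ℝ) : ‖WithLp.toLp 2 x‖ ^ 2 = ∑ l, x l ^ 2 := by
  rw [EuclideanSpace.real_norm_sq_eq]

theorem normSq_eq {p : ℕ} (δ : Fin p → ℝ) : normSq δ = ‖WithLp.toLp 2 δ‖ ^ 2 / p := by
  rw [norm_toLp_sq, normSq]

theorem quadSum_const_add {E : Type*} [NormedAddCommGroup E] [InnerProductSpace ℝ E]
    (m a k b : ℕ) (c : E) (x : ℕ → E) :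
    quadSum m a k b (fun i => c + x i) = quadSum m a k b x := by
  simp only [quadSum, add_sub_add_left_eq_sub]

theorem seqStat_eq {p : ℕ} {n m k : ℕ} (h : ¬(k ≤ m + 1 ∨ n ≤ k + m + 1)) (x : ℕ → Fin p → ℝ)
    (l : ℝ) : seqStat n m k x l = quadSum m ⌊l * (k : ℝ)⌋₊ k ⌊l * ((n - k : ℕ) : ℝ)⌋₊
      (fun i => WithLp.toLp 2 (x i)) / (numPairs m k * numPairs m (n - k) * p) := by
  rw [seqStat, if_neg h, one_div, inv_mul_eq_div, quadSum]
  simp_rw [← WithLp.toLp_sub, inner_toLp_eq_dotProduct]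

theorem cusumSq_eq {p : ℕ} {n k : ℕ} (hk1 : 1 ≤ k) (hkn : k ≤ n) (x : ℕ → Fin p → ℝ) :
    cusumSq n x k = ‖cusum n (fun i => WithLp.toLp 2 (x i)) k‖ ^ 2 / (n : ℝ) ^ 2 := by
  have hn : (n : ℝ) ≠ 0 := by
    have : n ≠ 0 := by omega
    exact_mod_cast this
  have hk : (k : ℝ) ≠ 0 := by
    have : k ≠ 0 := by omega
    exact_mod_cast this
  rw [EuclideanSpace.real_norm_sq_eq, cusumSq, sum_div]
  refine sum_congr rfl fun a _ => ?_
  rw [← div_pow]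
  congr 1
  have h0 : Icc 1 k = Ioc 0 k := by ext; simp only [Finset.mem_Icc, Finset.mem_Ioc]; omega
  have h1 : ∑ j ∈ Ioc 0 n, x j a = ∑ j ∈ Ioc 0 k, x j a + ∑ j ∈ Ioc k n, x j a :=
    (sum_Ioc_consecutive _ (Nat.zero_le k) hkn).symm
  have h2 : cusum n (fun i => WithLp.toLp 2 (x i)) k a
      = ∑ j ∈ Ioc 0 k, x j a - (k : ℝ) / n * ∑ j ∈ Ioc 0 n, x j a := by
    simp [cusum, WithLp.ofLp_sum]
  rw [h2, h0, h1]
  -- At k = n the second mean is a division by zero, but its prefactor vanishes and so does the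
  -- centred partial sum.
  rcases hkn.eq_or_lt with rfl | hlt
  · simp [hk]
  · have h3 : (n : ℝ) - k ≠ 0 := sub_ne_zero.2 (by exact_mod_cast hlt.ne')
    field_simp
    ring

/-- The squared linear noise terms of the sequential statistic at the true change point `k₀`. -/
noncomputable def linEnergy {E : Type*} [NormedAddCommGroup E] [InnerProductSpace ℝ E]
    (n m k₀ : ℕ) (d : E) (u : ℕ → E) (l : ℝ) : ℝ :=
  ⟪d, pairSum m 0 ⌊l * (k₀ : ℝ)⌋₊ u⟫ ^ 2
    + ⟪d, pairSum m k₀ (k₀ + ⌊l * ((n - k₀ : ℕ) : ℝ)⌋₊) u⟫ ^ 2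

theorem linEnergy_nonneg {E : Type*} [NormedAddCommGroup E] [InnerProductSpace ℝ E]
    (n m k₀ : ℕ) (d : E) (u : ℕ → E) (l : ℝ) : 0 ≤ linEnergy n m k₀ d u l := by
  unfold linEnergy; positivity

theorem floor_mul_le {l : ℝ} (h1 : l ≤ 1) (k : ℕ) : ⌊l * (k : ℝ)⌋₊ ≤ k :=
  Nat.floor_le_of_le (mul_le_of_le_one_left (Nat.cast_nonneg k) h1)

theorem floor_mul_le_add {l : ℝ} (h0 : 0 ≤ l) (h1 : l ≤ 1) {k k' R : ℕ} (h : k ≤ k' + R) :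
    ⌊l * (k : ℝ)⌋₊ ≤ ⌊l * (k' : ℝ)⌋₊ + R := by
  rw [← Nat.floor_add_natCast (by positivity)]
  refine Nat.floor_le_floor ?_
  have : (k : ℝ) ≤ k' + R := by exact_mod_cast h
  nlinarith [Nat.cast_nonneg (α := ℝ) R]

theorem measurable_floor_mul (k : ℕ) : Measurable fun l : unitInterval => ⌊(l : ℝ) * (k : ℝ)⌋₊ :=
  Nat.measurable_floor.comp (measurable_subtype_coe.mul_const _)

theorem integrable_comp_floor (ν : Measure unitInterval) [IsFiniteMeasure ν] (k : ℕ) (f : ℕ → ℝ) :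
    Integrable (fun l : unitInterval => f ⌊(l : ℝ) * (k : ℝ)⌋₊) ν := by
  refine Integrable.of_bound
    ((Measurable.of_discrete (f := f)).comp (measurable_floor_mul k)).aestronglyMeasurable
    (∑ j ∈ range (k + 1), |f j|) (Eventually.of_forall fun l => ?_)
  exact single_le_sum (f := fun j => |f j|) (fun _ _ => abs_nonneg _)
    (Finset.mem_range.2 (Nat.lt_succ_of_le (floor_mul_le l.2.2 k)))

theorem integrable_linEnergy {E : Type*} [NormedAddCommGroup E] [InnerProductSpace ℝ E]
    (ν : Measure unitInterval) [IsFiniteMeasure ν] (n m k₀ : ℕ) (d : E) (u : ℕ → E) :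
    Integrable (fun l : unitInterval => linEnergy n m k₀ d u l) ν :=
  (integrable_comp_floor ν k₀ fun a => ⟪d, pairSum m 0 a u⟫ ^ 2).add
    (integrable_comp_floor ν (n - k₀) fun b => ⟪d, pairSum m k₀ (k₀ + b) u⟫ ^ 2)

theorem centring_nonneg (n m k : ℕ) (l : ℝ) : 0 ≤ centring n m k l := by
  have := numPairs_nonneg m
  unfold centring
  exact mul_nonneg (div_nonneg (this _) (this _)) (div_nonneg (this _) (this _))

theorem centring_le_one (n m k : ℕ) {l : ℝ} (h1 : l ≤ 1) : centring n m k l ≤ 1 := by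
  have := numPairs_nonneg m
  unfold centring
  refine mul_le_one₀ ?_ (div_nonneg (this _) (this _)) ?_ <;>
  · refine div_le_one_of_le₀ (numPairs_mono m (floor_mul_le h1 _)) (this _)

/-- Puts the linear terms into squared form, so that they can be integrated over both `ν` and the
probability space. -/
theorem sq_add_scaled_le (X Y Z N : ℝ) :
    (72 * X + 2 * (|Y| + |Z|) / N ^ 2) ^ 2
      ≤ 2 * 72 ^ 2 * X ^ 2 + 16 * ((Y ^ 2 + Z ^ 2) / N ^ 4) := by
  refine add_sq_le.trans ?_
  have e1 : (2 * (|Y| + |Z|) / N ^ 2) ^ 2 = 4 * (|Y| + |Z|) ^ 2 / N ^ 4 := by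
    rw [div_pow, mul_pow, ← pow_mul]; norm_num
  have e2 : 4 * (|Y| + |Z|) ^ 2 / N ^ 4 ≤ 4 * (2 * (|Y| ^ 2 + |Z| ^ 2)) / N ^ 4 := by
    gcongr
    exact add_sq_le
  rw [sq_abs, sq_abs] at e2
  have e3 : 4 * (2 * (Y ^ 2 + Z ^ 2)) / N ^ 4 = 8 * ((Y ^ 2 + Z ^ 2) / N ^ 4) := by ring
  rw [mul_add, mul_pow, e1]
  linarith

/-- Writing T(l) - Λ T = (T(l) - Λ D) - Λ (T - D) removes the unknown mean `D`; then 0 ≤ Λ ≤ 1 and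
(x + y)² ≤ 2 x² + 2 y². -/
theorem integral_seqStat_sub_le {p : ℕ} (ν : Measure unitInterval) [IsProbabilityMeasure ν]
    (n m k : ℕ) (x : ℕ → Fin p → ℝ) (D A B G₁ : ℝ) (G : unitInterval → ℝ) (hG : Integrable G ν)
    (h : ∀ l : unitInterval, (seqStat n m k x l - centring n m k l * D) ^ 2 ≤ A + B * G l)
    (h1 : (stat n m k x - D) ^ 2 ≤ A + B * G₁) :
    ∫ l : unitInterval, (seqStat n m k x l - centring n m k l * stat n m k x) ^ 2 ∂ν
      ≤ 4 * A + 2 * B * (∫ l, G l ∂ν + G₁) := by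
  have hg : Integrable (fun l => 2 * B * G l) ν := hG.const_mul _
  refine (integral_mono_of_nonneg (Eventually.of_forall fun l => sq_nonneg _)
    (hg.add (integrable_const (4 * A + 2 * B * G₁))) (Eventually.of_forall fun l => ?_)).trans_eq ?_
  · have hl := h l
    have hΛ0 := centring_nonneg n m k (l : ℝ)
    have hΛ1 := centring_le_one n m k l.2.2
    have hΛ2 : centring n m k (l : ℝ) ^ 2 ≤ 1 := pow_le_one₀ hΛ0 hΛ1
    have hΛ3 : centring n m k (l : ℝ) ^ 2 * (stat n m k x - D) ^ 2
        ≤ 1 * (stat n m k x - D) ^ 2 := by gcongr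
    calc (seqStat n m k x l - centring n m k l * stat n m k x) ^ 2
        = ((seqStat n m k x l - centring n m k l * D)
          + -(centring n m k l * (stat n m k x - D))) ^ 2 := by ring
      _ ≤ 2 * ((seqStat n m k x l - centring n m k l * D) ^ 2
          + (-(centring n m k l * (stat n m k x - D))) ^ 2) := add_sq_le
      _ = 2 * (seqStat n m k x l - centring n m k l * D) ^ 2
          + 2 * (centring n m k (l : ℝ) ^ 2 * (stat n m k x - D) ^ 2) := by ring
      _ ≤ 2 * B * G l + (4 * A + 2 * B * G₁) := by linarith
  · rw [integral_add' hg (integrable_const _), integral_const_mul]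
    simp only [integral_const, probReal_univ, one_smul]
    ring

section

variable {p n m k₀ k R : ℕ} {γ θ M κ : ℝ} {μ δ : Fin p → ℝ} {x w : ℕ → Fin p → ℝ}

/-- The sequential statistic is close to its mean, up to the linear noise terms. -/
theorem sq_seqStat_sub_le (hp : 0 < p) (hκ : 0 < κ) (h1 : κ * n ≤ k₀) (h2 : κ * n ≤ n - k₀)
    (hn : 0 < n) (hk : k ≤ n) (hk₀ : k₀ ≤ n)
    (hγ0 : 0 ≤ γ) (hγ1 : γ ≤ 1) (hθ0 : 0 ≤ θ) (hθ1 : θ ≤ 1) (hθκ : θ ^ 2 ≤ κ / 2) (hM : 1 ≤ M)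
    (hm : (2 * m + 1) * (4 * M) ≤ θ * n) (hmκ : 4 * (2 * m + 1) ≤ κ * n)
    (hR : |(k : ℝ) - k₀| * M ≤ θ ^ 2 * n * γ)
    (hA : ∑ i ∈ Ioc 0 n, ‖WithLp.toLp 2 (w i)‖ ^ 2 ≤ M * n * γ * ‖WithLp.toLp 2 δ‖ ^ 2)
    (hS : ∀ j ≤ n, ‖∑ i ∈ Ioc 0 j, WithLp.toLp 2 (w i)‖ ≤ θ * n * (√γ * ‖WithLp.toLp 2 δ‖))
    (hx : ∀ i, x i = μ + w i + if i ≤ k₀ then 0 else δ) {l : ℝ} (hl0 : 0 ≤ l) (hl1 : l ≤ 1) :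
    (seqStat n m k x l - centring n m k l * normSq δ) ^ 2
      ≤ ((64 / κ ^ 4) / p) ^ 2 * (2 * 72 ^ 2 * (θ * γ * ‖WithLp.toLp 2 δ‖ ^ 2) ^ 2
        + 16 * (linEnergy n m k₀ (WithLp.toLp 2 δ) (fun i => WithLp.toLp 2 (w i)) l / n ^ 4)) := by
  have hn' : (0 : ℝ) < n := by positivity
  have hp' : (0 : ℝ) < p := by positivity
  obtain ⟨R, hRk⟩ : ∃ R : ℕ, (R : ℝ) = |(k : ℝ) - k₀| :=
    ⟨((k : ℤ) - k₀).natAbs, by rw [Nat.cast_natAbs]; push_cast; rfl⟩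
  rw [← hRk] at hR
  have hw1 : k ≤ k₀ + R := by
    have := (le_abs_self ((k : ℝ) - k₀)).trans_eq hRk.symm
    have h : (k : ℝ) ≤ k₀ + R := by linarith
    exact_mod_cast h
  have hw2 : k₀ ≤ k + R := by
    have := (neg_le_abs ((k : ℝ) - k₀)).trans_eq hRk.symm
    have h : (k₀ : ℝ) ≤ k + R := by linarith
    exact_mod_cast h
  have hRn : (R : ℝ) ≤ κ / 2 * n := by
    calc (R : ℝ) ≤ R * M := le_mul_of_one_le_right (by positivity) hM
      _ ≤ θ ^ 2 * n * γ := hR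
      _ ≤ κ / 2 * n * 1 := by gcongr
      _ = _ := by ring
  have hw1' : (k : ℝ) ≤ k₀ + R := by exact_mod_cast hw1
  have hw2' : (k₀ : ℝ) ≤ k + R := by exact_mod_cast hw2
  have hkn : κ * n / 2 ≤ k := by linarith
  have hnk : κ * n / 2 ≤ ((n - k : ℕ) : ℝ) := by rw [Nat.cast_sub hk]; linarith
  have hm0 : (0 : ℝ) ≤ m := Nat.cast_nonneg m
  have hdeg : ¬(k ≤ m + 1 ∨ n ≤ k + m + 1) := by
    rintro (h | h)
    · have : (k : ℝ) ≤ m + 1 := by exact_mod_cast h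
      linarith
    · have : (n : ℝ) ≤ k + m + 1 := by exact_mod_cast h
      rw [Nat.cast_sub hk] at hnk
      linarith
  -- Both segments have length at least κ n / 2 because `θ ^ 2 ≤ κ / 2`, and trimming removes at
  -- most κ n / 4. The product of the two counts yields the factor 64 / κ⁴.
  have hN : ∀ j : ℕ, κ * n / 2 ≤ j → κ ^ 2 * n ^ 2 / 8 ≤ numPairs m j := fun j hj => by
    refine le_trans ?_ (le_numPairs m j)
    have h3 : κ * n / 4 ≤ (j : ℝ) - (2 * m + 1) := by linarith
    calc _ = κ * n / 2 * (κ * n / 4) := by ring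
      _ ≤ _ := by gcongr
  have hNk := hN k hkn
  have hNn := hN (n - k) hnk
  have hpos : 0 < κ ^ 2 * n ^ 2 / 8 := by positivity
  have hNk0 : 0 < numPairs m k := hpos.trans_le hNk
  have hNn0 : 0 < numPairs m (n - k) := hpos.trans_le hNn
  set d := WithLp.toLp 2 δ with hd
  set u : ℕ → EuclideanSpace ℝ (Fin p) := fun i => WithLp.toLp 2 (w i) with hu
  set a := ⌊l * (k : ℝ)⌋₊ with ha
  set b := ⌊l * ((n - k : ℕ) : ℝ)⌋₊ with hb
  set a₀ := ⌊l * (k₀ : ℝ)⌋₊ with ha₀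
  set b₀ := ⌊l * ((n - k₀ : ℕ) : ℝ)⌋₊ with hb₀
  have hbn : b ≤ n - k := floor_mul_le hl1 _
  have hbn₀ : b₀ ≤ n - k₀ := floor_mul_le hl1 _
  have hq := abs_quadSum_sub_le (m := m) (a := a) (a₀ := a₀) (b := b) (b₀ := b₀) hγ0 hγ1 hθ0 hθ1
    hM hm (floor_mul_le hl1 _) (by omega) (floor_mul_le hl1 _) (by omega) hw1 hw2
    (floor_mul_le_add hl0 hl1 hw1) (floor_mul_le_add hl0 hl1 hw2)
    (floor_mul_le_add hl0 hl1 (by omega)) (floor_mul_le_add hl0 hl1 (by omega)) hR hA hS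
    (x := fun i => u i + if i ≤ k₀ then 0 else d) fun i => rfl
  have hxq : quadSum m a k b (fun i => WithLp.toLp 2 (x i))
      = quadSum m a k b fun i => u i + if i ≤ k₀ then 0 else d := by
    refine Eq.trans ?_ (quadSum_const_add m a k b (WithLp.toLp 2 μ) _)
    congr 1
    ext1 i
    rw [hx i, WithLp.toLp_add, WithLp.toLp_add, add_assoc]
    split_ifs <;> simp [hu, hd]
  rw [← hxq] at hq
  set Q := quadSum m a k b (fun i => WithLp.toLp 2 (x i))
  set L1 := ⟪d, pairSum m 0 a₀ u⟫
  set L2 := ⟪d, pairSum m k₀ (k₀ + b₀) u⟫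
  have hE : linEnergy n m k₀ d u l = L1 ^ 2 + L2 ^ 2 := rfl
  have herr : seqStat n m k x l - centring n m k l * normSq δ
      = (Q - numPairs m a * numPairs m b * ‖d‖ ^ 2) / (numPairs m k * numPairs m (n - k) * p) := by
    rw [seqStat_eq hdeg, centring, normSq_eq]
    field_simp
    rfl
  have hden : κ ^ 4 / 64 * n ^ 4 * p ≤ numPairs m k * numPairs m (n - k) * p := by
    refine mul_le_mul_of_nonneg_right ?_ hp'.le
    calc κ ^ 4 / 64 * n ^ 4 = κ ^ 2 * n ^ 2 / 8 * (κ ^ 2 * n ^ 2 / 8) := by ring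
      _ ≤ _ := by gcongr
  have hbound : |seqStat n m k x l - centring n m k l * normSq δ|
      ≤ (64 / κ ^ 4) / p * (72 * (θ * γ * ‖d‖ ^ 2) + 2 * (|L1| + |L2|) / n ^ 2) := by
    rw [herr, abs_div, abs_of_pos (by positivity : 0 < numPairs m k * numPairs m (n - k) * p)]
    calc _ ≤ (72 * θ * n ^ 4 * (γ * ‖d‖ ^ 2) + 2 * n ^ 2 * (|L1| + |L2|))
          / (κ ^ 4 / 64 * n ^ 4 * p) := by gcongr
      _ = _ := by field_simp
  rw [hE, ← sq_abs]
  calc _ ≤ ((64 / κ ^ 4) / p * (72 * (θ * γ * ‖d‖ ^ 2) + 2 * (|L1| + |L2|) / n ^ 2)) ^ 2 := by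
        gcongr
    _ = ((64 / κ ^ 4) / p) ^ 2
        * (72 * (θ * γ * ‖d‖ ^ 2) + 2 * (|L1| + |L2|) / n ^ 2) ^ 2 := by ring
    _ ≤ _ := by
        gcongr
        exact sq_add_scaled_le _ _ _ _

/-- The statistic is close to the size of the change and the self-normalizer is small. -/
theorem abs_stat_sub_le_and_selfNormalizer_le (hp : 0 < p) (hκ : 0 < κ) (h1 : κ * n ≤ k₀)
    (h2 : κ * n ≤ n - k₀) (hn : 0 < n) (hk : k ≤ n) (hk₀ : k₀ ≤ n)
    (hγ0 : 0 ≤ γ) (hγ1 : γ ≤ 1) (hθ0 : 0 ≤ θ) (hθ1 : θ ≤ 1) (hθκ : θ ^ 2 ≤ κ / 2) (hM : 1 ≤ M)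
    (hm : (2 * m + 1) * (4 * M) ≤ θ * n) (hmκ : 4 * (2 * m + 1) ≤ κ * n)
    (hR : |(k : ℝ) - k₀| * M ≤ θ ^ 2 * n * γ)
    (hA : ∑ i ∈ Ioc 0 n, ‖WithLp.toLp 2 (w i)‖ ^ 2 ≤ M * n * γ * ‖WithLp.toLp 2 δ‖ ^ 2)
    (hS : ∀ j ≤ n, ‖∑ i ∈ Ioc 0 j, WithLp.toLp 2 (w i)‖ ≤ θ * n * (√γ * ‖WithLp.toLp 2 δ‖))
    (hx : ∀ i, x i = μ + w i + if i ≤ k₀ then 0 else δ)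
    (ν : Measure unitInterval) [IsProbabilityMeasure ν]
    (hJ : ∫ l : unitInterval,
        linEnergy n m k₀ (WithLp.toLp 2 δ) (fun i => WithLp.toLp 2 (w i)) l ∂ν
      + linEnergy n m k₀ (WithLp.toLp 2 δ) (fun i => WithLp.toLp 2 (w i)) 1
      ≤ n ^ 4 * (θ * γ * ‖WithLp.toLp 2 δ‖ ^ 2) ^ 2) :
    |stat n m k x - normSq δ| ≤ 204 * (64 / κ ^ 4) * θ * γ * normSq δ ∧
      selfNormalizer ν n m k x ≤ 204 * (64 / κ ^ 4) * θ * γ * normSq δ := by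
  have hp' : (0 : ℝ) < p := by positivity
  have hn' : (0 : ℝ) < n := by positivity
  have key := @sq_seqStat_sub_le p n m k₀ k γ θ M κ μ δ x w hp hκ h1 h2 hn hk hk₀ hγ0 hγ1 hθ0
    hθ1 hθκ hM hm hmκ hR hA hS hx
  have hc1 : centring n m k 1 = 1 := by
    have hκn : 0 < κ * n := by positivity
    have hR1 : |(k : ℝ) - k₀| ≤ κ / 2 * n := by
      calc _ ≤ |(k : ℝ) - k₀| * M := le_mul_of_one_le_right (abs_nonneg _) hM
        _ ≤ θ ^ 2 * n * γ := hR
        _ ≤ κ / 2 * n * 1 := by gcongr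
        _ = _ := by ring
    rw [abs_le] at hR1
    have hm0 : (0 : ℝ) ≤ m := Nat.cast_nonneg m
    have hN : ∀ j : ℕ, κ * n / 2 ≤ j → numPairs m j ≠ 0 := fun j hj => by
      refine (lt_of_lt_of_le ?_ (le_numPairs m j)).ne'
      apply mul_pos <;> linarith
    rw [centring, one_mul, one_mul, Nat.floor_natCast, Nat.floor_natCast,
      div_self (hN k (by linarith)), div_self (hN (n - k) (by rw [Nat.cast_sub hk]; linarith)),
      one_mul]
  have hone := key zero_le_one le_rfl
  have hint := integrable_linEnergy ν n m k₀ (WithLp.toLp 2 δ) fun i => WithLp.toLp 2 (w i)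
  have hI0 : 0 ≤ ∫ l : unitInterval,
      linEnergy n m k₀ (WithLp.toLp 2 δ) (fun i => WithLp.toLp 2 (w i)) l ∂ν :=
    integral_nonneg fun l => linEnergy_nonneg _ _ _ _ _ _
  have hE0 := linEnergy_nonneg n m k₀ (WithLp.toLp 2 δ) (fun i => WithLp.toLp 2 (w i)) 1
  have hD : 204 * (64 / κ ^ 4) * θ * γ * normSq δ
      = 204 * ((64 / κ ^ 4) / p * (θ * γ * ‖WithLp.toLp 2 δ‖ ^ 2)) := by
    rw [normSq_eq]; ring
  rw [hD]
  rw [hc1, one_mul] at hone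
  have hX0 : 0 ≤ θ * γ * ‖WithLp.toLp 2 δ‖ ^ 2 := by positivity
  have hc0 : 0 ≤ (64 / κ ^ 4) / (p : ℝ) := by positivity
  generalize θ * γ * ‖WithLp.toLp 2 δ‖ ^ 2 = X at hX0 hone key hJ ⊢
  generalize (64 / κ ^ 4) / (p : ℝ) = c at hc0 hone key ⊢
  generalize linEnergy n m k₀ (WithLp.toLp 2 δ) (fun i => WithLp.toLp 2 (w i)) = G at *
  have hn4 : (0 : ℝ) < n ^ 4 := by positivity
  have hJ' : ((∫ l : unitInterval, G l ∂ν) + G 1) / n ^ 4 ≤ X ^ 2 := by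
    rw [div_le_iff₀ hn4]
    linarith
  have hG1 : G 1 / n ^ 4 ≤ X ^ 2 := by
    refine le_trans ?_ hJ'
    gcongr
    linarith
  -- 204² = 41616 dominates both 2 · 72² + 16 = 10384 for the statistic and 8 · 72² + 32 = 41504 for
  -- the self-normalizer.
  constructor
  · refine abs_le_of_sq_le_sq (hone.trans ?_) (by positivity)
    calc _ ≤ c ^ 2 * (2 * 72 ^ 2 * X ^ 2 + 16 * X ^ 2) := by gcongr
      _ = 10384 * (c * X) ^ 2 := by ring
      _ ≤ 41616 * (c * X) ^ 2 := by gcongr; norm_num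
      _ = _ := by ring
  · rw [selfNormalizer]
    refine Real.sqrt_le_iff.2 ⟨by positivity, ?_⟩
    refine (integral_seqStat_sub_le ν n m k x (normSq δ) (c ^ 2 * (2 * 72 ^ 2 * X ^ 2))
      (c ^ 2 * 16 / n ^ 4) (G 1) (fun l => G l) hint (fun l => ?_) ?_).trans ?_
    · refine (key l.2.1 l.2.2).trans_eq ?_
      ring
    · refine hone.trans_eq ?_
      ring
    · calc _ = c ^ 2 * (4 * (2 * 72 ^ 2 * X ^ 2)
            + 32 * (((∫ l : unitInterval, G l ∂ν) + G 1) / n ^ 4)) := by ring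
        _ ≤ c ^ 2 * (4 * (2 * 72 ^ 2 * X ^ 2) + 32 * X ^ 2) := by gcongr
        _ = 41504 * (c * X) ^ 2 := by ring
        _ ≤ _ := by nlinarith [sq_nonneg (c * X)]

end

/-! ### Second moments of the noise -/

theorem abs_inner_toEuclideanCLM_le {p : ℕ} (A : Matrix (Fin p) (Fin p) ℝ) (x y : Fin p → ℝ) :
    |∑ a, ∑ b, x a * A a b * y b| ≤ spectralNorm A * (‖WithLp.toLp 2 x‖ * ‖WithLp.toLp 2 y‖) := by
  have h : ∑ a, ∑ b, x a * A a b * y b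
      = ⟪WithLp.toLp 2 x, Matrix.toEuclideanCLM (𝕜 := ℝ) A (WithLp.toLp 2 y)⟫ := by
    rw [Matrix.toEuclideanCLM_toLp, inner_toLp_eq_dotProduct]
    simp only [dotProduct, Matrix.mulVec, mul_sum, mul_assoc]
  rw [h]
  refine (abs_real_inner_le_norm _ _).trans ?_
  have := (Matrix.toEuclideanCLM (𝕜 := ℝ) A).le_opNorm (WithLp.toLp 2 y)
  calc _ ≤ ‖WithLp.toLp 2 x‖ * (spectralNorm A * ‖WithLp.toLp 2 y‖) := by
        gcongr; exact this
    _ = _ := by ring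

theorem abs_apply_le_spectralNorm {p : ℕ} (A : Matrix (Fin p) (Fin p) ℝ) (a b : Fin p) :
    |A a b| ≤ spectralNorm A := by
  have h := abs_inner_toEuclideanCLM_le A (Pi.single a 1) (Pi.single b 1)
  simpa [Pi.single_apply] using h

theorem spectralNorm_nonneg {p : ℕ} (A : Matrix (Fin p) (Fin p) ℝ) : 0 ≤ spectralNorm A :=
  norm_nonneg _

/-- A centred second-order stationary series with summable autocovariances. -/
structure IsCentredStationary {Ω : Type*} [MeasurableSpace Ω] {p : ℕ} (P : Measure Ω)
    (U : ℤ → Ω → Fin p → ℝ) : Prop where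
  memLp : ∀ j a, MemLp (fun ω => U j ω a) 2 P
  centred : ∀ j a, ∫ ω, U j ω a ∂P = 0
  stationary : ∀ (i j : ℤ) (a b : Fin p),
    cov[fun ω => U i ω a, fun ω => U j ω b; P] = autocov P U (j - i) a b
  summable : Summable fun h : ℕ => spectralNorm (autocov P U h)

namespace IsCentredStationary

variable {Ω : Type*} [MeasurableSpace Ω] {p : ℕ} {P : Measure Ω}
  {U : ℤ → Ω → Fin p → ℝ}

theorem integrable_mul (hU : IsCentredStationary P U) (i j : ℤ) (a b : Fin p) :
    Integrable (fun ω => U i ω a * U j ω b) P :=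
  (hU.memLp i a).integrable_mul (hU.memLp j b)

theorem integral_mul [IsProbabilityMeasure P] (hU : IsCentredStationary P U) (i j : ℤ) (a b : Fin p) :
    ∫ ω, U i ω a * U j ω b ∂P = autocov P U (j - i) a b := by
  rw [← hU.stationary, covariance_eq_sub (hU.memLp i a) (hU.memLp j b), hU.centred i a,
    zero_mul, sub_zero]
  rfl

theorem autocov_neg [IsProbabilityMeasure P] (hU : IsCentredStationary P U) (h : ℤ) (a b : Fin p) :
    autocov P U (-h) a b = autocov P U h b a := by
  have h1 := hU.integral_mul h 0 a b
  have h2 := hU.integral_mul 0 h b a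
  rw [zero_sub] at h1
  rw [sub_zero] at h2
  rw [← h1, ← h2]
  exact integral_congr_ae (Eventually.of_forall fun ω => mul_comm _ _)

theorem summable_abs_autocov [IsProbabilityMeasure P] (hU : IsCentredStationary P U) (a b : Fin p) :
    Summable fun h : ℤ => |autocov P U h a b| := by
  refine Summable.of_nat_of_neg ?_ ?_
  · exact Summable.of_nonneg_of_le (fun _ => abs_nonneg _)
      (fun h => abs_apply_le_spectralNorm _ a b) hU.summable
  · simp_rw [hU.autocov_neg]
    exact Summable.of_nonneg_of_le (fun _ => abs_nonneg _)
      (fun h => abs_apply_le_spectralNorm _ b a) hU.summable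

theorem sum_abs_autocov_le [IsProbabilityMeasure P] (hU : IsCentredStationary P U) (a b : Fin p) (i : ℤ) (I : Finset ℕ) :
    ∑ j ∈ I, |autocov P U (j - i) a b| ≤ gammaBar P U a b := by
  have hinj : Set.InjOn (fun j : ℕ => (j : ℤ) - i) I := fun x _ y _ h => by
    simpa using h
  rw [← sum_image (f := fun h => |autocov P U h a b|) hinj]
  exact (hU.summable_abs_autocov a b).sum_le_tsum _ fun _ _ => abs_nonneg _

theorem gammaBar_nonneg (P : Measure Ω) (U : ℤ → Ω → Fin p → ℝ) (a b : Fin p) :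
    0 ≤ gammaBar P U a b :=
  tsum_nonneg fun _ => abs_nonneg _

theorem trace_nonneg (P : Measure Ω) (U : ℤ → Ω → Fin p → ℝ) : 0 ≤ (gammaBar P U).trace :=
  sum_nonneg fun _ _ => gammaBar_nonneg P U _ _

theorem memLp_sum (hU : IsCentredStationary P U) (I : Finset ℕ) (a : Fin p) :
    MemLp (fun ω => ∑ i ∈ I, U i ω a) 2 P :=
  memLp_finsetSum I fun i _ => hU.memLp i a

theorem norm_sum_toLp_sq {Ω : Type*} (U : ℤ → Ω → Fin p → ℝ) (I : Finset ℕ) (ω : Ω) :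
    ‖∑ i ∈ I, WithLp.toLp 2 (U i ω)‖ ^ 2 = ∑ a, (∑ i ∈ I, U i ω a) ^ 2 := by
  rw [← WithLp.toLp_sum, norm_toLp_sq]
  simp

theorem integrable_norm_sum_sq (hU : IsCentredStationary P U) (I : Finset ℕ) :
    Integrable (fun ω => ‖∑ i ∈ I, WithLp.toLp 2 (U i ω)‖ ^ 2) P := by
  simp_rw [norm_sum_toLp_sq]
  exact integrable_finsetSum _ fun a _ => (hU.memLp_sum I a).integrable_sq

/-- Only diagonal entries of the autocovariances occur, and for each fixed `i` the lags j - i are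
distinct, so the inner sum is at most a diagonal entry of Γ̄. -/
theorem integral_norm_sum_sq_le [IsProbabilityMeasure P] (hU : IsCentredStationary P U) (I : Finset ℕ) :
    ∫ ω, ‖∑ i ∈ I, WithLp.toLp 2 (U i ω)‖ ^ 2 ∂P ≤ #I * (gammaBar P U).trace := by
  simp_rw [norm_sum_toLp_sq]
  rw [integral_finsetSum _ fun a _ => (hU.memLp_sum I a).integrable_sq, Matrix.trace, mul_sum]
  refine sum_le_sum fun a _ => ?_
  simp_rw [sq, sum_mul_sum]
  rw [integral_finsetSum _ fun (i : ℕ) _ => integrable_finsetSum _ fun (j : ℕ) _ =>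
      hU.integrable_mul i j a a,
    ← nsmul_eq_mul, ← sum_const]
  refine sum_le_sum fun i _ => ?_
  rw [integral_finsetSum _ fun (j : ℕ) _ => hU.integrable_mul i j a a]
  simp_rw [hU.integral_mul]
  exact (sum_le_sum fun j _ => le_abs_self _).trans (hU.sum_abs_autocov_le a a i I)

theorem inner_toLp_eq_sum {Ω : Type*} {U : ℤ → Ω → Fin p → ℝ} (δ : Fin p → ℝ) (i : ℤ) (ω : Ω) :
    ⟪WithLp.toLp 2 δ, WithLp.toLp 2 (U i ω)⟫ = ∑ a, δ a * U i ω a := by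
  rw [inner_toLp_eq_dotProduct, dotProduct]

theorem memLp_inner (hU : IsCentredStationary P U) (δ : Fin p → ℝ) (i : ℤ) :
    MemLp (fun ω => ⟪WithLp.toLp 2 δ, WithLp.toLp 2 (U i ω)⟫) 2 P := by
  simp_rw [inner_toLp_eq_sum]
  exact memLp_finsetSum _ fun a _ => (hU.memLp i a).const_mul _

theorem abs_integral_inner_mul_inner_le [IsProbabilityMeasure P] (hU : IsCentredStationary P U) (δ : Fin p → ℝ) (i j : ℤ) :
    |∫ ω, ⟪WithLp.toLp 2 δ, WithLp.toLp 2 (U i ω)⟫ * ⟪WithLp.toLp 2 δ, WithLp.toLp 2 (U j ω)⟫ ∂P|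
      ≤ spectralNorm (autocov P U (j - i)) * ‖WithLp.toLp 2 δ‖ ^ 2 := by
  have h : ∫ ω, ⟪WithLp.toLp 2 δ, WithLp.toLp 2 (U i ω)⟫
        * ⟪WithLp.toLp 2 δ, WithLp.toLp 2 (U j ω)⟫ ∂P
      = ∑ a, ∑ b, δ a * autocov P U (j - i) a b * δ b := by
    simp_rw [inner_toLp_eq_sum, sum_mul_sum]
    have e : ∀ (a b : Fin p) (ω : Ω), δ a * U i ω a * (δ b * U j ω b)
        = δ a * δ b * (U i ω a * U j ω b) := fun a b ω => by ring
    simp_rw [e]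
    rw [integral_finsetSum _ fun a _ => integrable_finsetSum _ fun b _ =>
      (hU.integrable_mul i j a b).const_mul _]
    refine sum_congr rfl fun a _ => ?_
    rw [integral_finsetSum _ fun b _ => (hU.integrable_mul i j a b).const_mul _]
    refine sum_congr rfl fun b _ => ?_
    rw [integral_const_mul, hU.integral_mul]
    ring
  rw [h, sq]
  exact abs_inner_toEuclideanCLM_le _ _ _

/-- Symmetry of the product reduces negative lags to positive ones, as summability of the spectral
norms is given only over h ≥ 0. -/
theorem abs_integral_inner_mul_inner_le_natAbs [IsProbabilityMeasure P] (hU : IsCentredStationary P U) (δ : Fin p → ℝ)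
    (i j : ℤ) :
    |∫ ω, ⟪WithLp.toLp 2 δ, WithLp.toLp 2 (U i ω)⟫ * ⟪WithLp.toLp 2 δ, WithLp.toLp 2 (U j ω)⟫ ∂P|
      ≤ spectralNorm (autocov P U ((j - i).natAbs : ℤ)) * ‖WithLp.toLp 2 δ‖ ^ 2 := by
  rcases le_total i j with h | h
  · rw [Int.natAbs_of_nonneg (by omega)]
    exact hU.abs_integral_inner_mul_inner_le δ i j
  · have e : ((j - i).natAbs : ℤ) = i - j := by omega
    rw [e]
    simp_rw [mul_comm ⟪WithLp.toLp 2 δ, WithLp.toLp 2 (U i _)⟫]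
    exact hU.abs_integral_inner_mul_inner_le δ j i

theorem sum_natAbs_sub_le {f : ℕ → ℝ} (hf : Summable f) (h0 : ∀ h, 0 ≤ f h) (i : ℕ)
    (I : Finset ℕ) : ∑ j ∈ I, f ((j : ℤ) - i).natAbs ≤ 2 * ∑' h, f h := by
  classical
  have key : ∀ J : Finset ℕ, Set.InjOn (fun j : ℕ => ((j : ℤ) - i).natAbs) J →
      ∑ j ∈ J, f ((j : ℤ) - i).natAbs ≤ ∑' h, f h := fun J hJ => by
    rw [← sum_image (f := f) hJ]
    exact hf.sum_le_tsum _ fun _ _ => h0 _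
  rw [← sum_filter_add_sum_filter_not I (fun j => i ≤ j), two_mul]
  refine add_le_add (key _ ?_) (key _ ?_) <;>
  · intro x hx y hy hxy
    simp only [coe_filter, Set.mem_ofPred_eq] at hx hy hxy
    omega

/-- The variance bound for linear forms in the noise. -/
theorem integral_sq_sum_inner_le [IsProbabilityMeasure P] (hU : IsCentredStationary P U) (δ : Fin p → ℝ) (I : Finset ℕ)
    (v : ℕ → ℝ) {V : ℝ} (hV : ∀ i, |v i| ≤ V) :
    ∫ ω, (∑ i ∈ I, v i * ⟪WithLp.toLp 2 δ, WithLp.toLp 2 (U i ω)⟫) ^ 2 ∂P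
      ≤ 2 * #I * V ^ 2 * (∑' h : ℕ, spectralNorm (autocov P U h)) * ‖WithLp.toLp 2 δ‖ ^ 2 := by
  have hV0 : 0 ≤ V := (abs_nonneg _).trans (hV 0)
  have e : ∀ (i j : ℕ) (ω : Ω), v i * ⟪WithLp.toLp 2 δ, WithLp.toLp 2 (U i ω)⟫
      * (v j * ⟪WithLp.toLp 2 δ, WithLp.toLp 2 (U j ω)⟫)
      = v i * v j * (⟪WithLp.toLp 2 δ, WithLp.toLp 2 (U i ω)⟫
        * ⟪WithLp.toLp 2 δ, WithLp.toLp 2 (U j ω)⟫) := fun i j ω => by ring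
  have hint : ∀ i j : ℕ, Integrable (fun ω => v i * v j * (⟪WithLp.toLp 2 δ, WithLp.toLp 2 (U i ω)⟫
        * ⟪WithLp.toLp 2 δ, WithLp.toLp 2 (U j ω)⟫)) P := fun i j =>
    ((hU.memLp_inner δ i).integrable_mul (hU.memLp_inner δ j)).const_mul _
  simp_rw [sq, sum_mul_sum, e]
  rw [integral_finsetSum _ fun i _ => integrable_finsetSum _ fun j _ => hint i j]
  have hi : ∀ i ∈ I, ∫ ω, ∑ j ∈ I, v i * v j * (⟪WithLp.toLp 2 δ, WithLp.toLp 2 (U i ω)⟫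
        * ⟪WithLp.toLp 2 δ, WithLp.toLp 2 (U j ω)⟫) ∂P
      ≤ V ^ 2 * (2 * ∑' h : ℕ, spectralNorm (autocov P U h)) * ‖WithLp.toLp 2 δ‖ ^ 2 := by
    intro i _
    rw [integral_finsetSum _ fun j _ => hint i j]
    calc _ ≤ ∑ j ∈ I, V ^ 2 * spectralNorm (autocov P U (((j : ℤ) - i).natAbs : ℤ))
          * ‖WithLp.toLp 2 δ‖ ^ 2 := by
          refine sum_le_sum fun j _ => ?_
          rw [integral_const_mul]
          refine (le_abs_self _).trans ?_
          rw [abs_mul, abs_mul, sq V, mul_assoc (V * V)]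
          have h1 := hV i
          have h2 := hV j
          have h3 := hU.abs_integral_inner_mul_inner_le_natAbs δ i j
          gcongr
      _ = V ^ 2 * (∑ j ∈ I, spectralNorm (autocov P U (((j : ℤ) - i).natAbs : ℤ)))
          * ‖WithLp.toLp 2 δ‖ ^ 2 := by rw [mul_sum, sum_mul]
      _ ≤ _ := by
          gcongr
          exact sum_natAbs_sub_le (f := fun h => spectralNorm (autocov P U h)) hU.summable
            (fun h => spectralNorm_nonneg _) i I
  refine (sum_le_sum hi).trans_eq ?_
  rw [sum_const, nsmul_eq_mul]
  ring

theorem integrable_sq_sum_inner (hU : IsCentredStationary P U) (δ : Fin p → ℝ) (I : Finset ℕ)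
    (v : ℕ → ℝ) :
    Integrable (fun ω => (∑ i ∈ I, v i * ⟪WithLp.toLp 2 δ, WithLp.toLp 2 (U i ω)⟫) ^ 2) P :=
  (memLp_finsetSum I fun i _ => (hU.memLp_inner δ i).const_mul (v i)).integrable_sq

/-- The number of indices in `(a, b]` that are separated from `i`. -/
def sepCount (m a b i : ℕ) : ℝ := ((Ioc a b).filter fun j : ℕ => (m : ℤ) < |(i : ℤ) - (j : ℤ)|).card

/-- This turns the sum over pairs into a weighted linear form with weights at most n, to which the
variance bound applies. -/
theorem pairSum_eq_sum_sepCount (m a b : ℕ) (z : ℕ → ℝ) :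
    pairSum m a b z = ∑ i ∈ Ioc a b, sepCount m a b i * z i := by
  rw [pairSum, sepPairs, sum_filter, sum_product]
  refine sum_congr rfl fun i _ => ?_
  simp only [← sum_filter, sum_const, nsmul_eq_mul, sepCount]

theorem abs_sepCount_le (m i : ℕ) {a b n : ℕ} (h : b ≤ n) : |sepCount m a b i| ≤ n := by
  rw [sepCount, abs_of_nonneg (Nat.cast_nonneg _)]
  refine Nat.cast_le.2 ((card_filter_le _ _).trans ?_)
  rw [Nat.card_Ioc]
  omega

theorem integrable_sq_inner_pairSum (hU : IsCentredStationary P U) (δ : Fin p → ℝ) (m a b : ℕ) :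
    Integrable (fun ω => ⟪WithLp.toLp 2 δ, pairSum m a b fun i => WithLp.toLp 2 (U i ω)⟫ ^ 2) P := by
  simp_rw [inner_pairSum, pairSum_eq_sum_sepCount]
  exact hU.integrable_sq_sum_inner δ _ _

theorem integral_sq_inner_pairSum_le [IsProbabilityMeasure P] (hU : IsCentredStationary P U) (δ : Fin p → ℝ) (m : ℕ)
    {a b n : ℕ} (h : b ≤ n) :
    ∫ ω, ⟪WithLp.toLp 2 δ, pairSum m a b fun i => WithLp.toLp 2 (U i ω)⟫ ^ 2 ∂P
      ≤ 2 * n ^ 3 * (∑' h : ℕ, spectralNorm (autocov P U h)) * ‖WithLp.toLp 2 δ‖ ^ 2 := by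
  simp_rw [inner_pairSum, pairSum_eq_sum_sepCount]
  refine (hU.integral_sq_sum_inner_le δ _ _ fun i => abs_sepCount_le m i h).trans ?_
  have h0 : 0 ≤ ∑' h : ℕ, spectralNorm (autocov P U h) := tsum_nonneg fun _ => spectralNorm_nonneg _
  have hc : (#(Ioc a b) : ℝ) ≤ n := by
    rw [Nat.card_Ioc]
    exact_mod_cast (by omega : b - a ≤ n)
  rw [show 2 * (n : ℝ) ^ 3 = 2 * n * n ^ 2 by ring]
  gcongr

end IsCentredStationary

/-! ### The event on which the noise is small -/

/-- The noise path `u` is small compared with the signal `d`. -/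
structure IsSmallNoise {E : Type*} [NormedAddCommGroup E] [InnerProductSpace ℝ E]
    (ν : Measure unitInterval) (n m k₀ : ℕ) (γ θ ξ M : ℝ) (d : E) (u : ℕ → E) : Prop where
  energy : ∑ i ∈ Ioc 0 n, ‖u i‖ ^ 2 ≤ M * n * γ * ‖d‖ ^ 2
  partialSum : ∀ j ≤ n, ‖∑ i ∈ Ioc 0 j, u i‖ ≤ ξ * n * (√γ * ‖d‖)
  increment : ∀ k ≤ n, θ ^ 2 * n * γ < |(k : ℝ) - k₀| * M →
    |⟪d, ∑ i ∈ Ioc 0 k, u i - ∑ i ∈ Ioc 0 k₀, u i⟫| ≤ ξ * |(k : ℝ) - k₀| * ‖d‖ ^ 2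
  linear : ∫ l : unitInterval, linEnergy n m k₀ d u l ∂ν + linEnergy n m k₀ d u 1
      ≤ n ^ 4 * (θ * γ * ‖d‖ ^ 2) ^ 2

/-- Markov's inequality for strict exceedance, which is the negation of the bounds in
`IsSmallNoise`. -/
theorem measure_lt_le_of_integral_le {Ω : Type*} [MeasurableSpace Ω] {P : Measure Ω}
    [IsFiniteMeasure P] {f : Ω → ℝ} (h0 : ∀ ω, 0 ≤ f ω) (hf : Integrable f P) {b t η : ℝ}
    (ht : 0 < t) (hb : ∫ ω, f ω ∂P ≤ b) (hη : b ≤ η * t) :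
    P {ω | t < f ω} ≤ ENNReal.ofReal η := by
  have h1 := mul_meas_ge_le_integral_of_nonneg (Eventually.of_forall h0) hf t
  have h2 : P.real {ω | t ≤ f ω} ≤ η := by
    refine le_of_mul_le_mul_left ?_ ht
    linarith
  calc P {ω | t < f ω} ≤ P {ω | t ≤ f ω} := measure_mono fun ω (h : t < f ω) => h.le
    _ = ENNReal.ofReal (P.real {ω | t ≤ f ω}) := (ofReal_measureReal).symm
    _ ≤ _ := ENNReal.ofReal_le_ofReal h2

/-- A bound for all partial sums that is cheap to integrate. -/
theorem norm_sum_sq_le_of_pos {E : Type*} [NormedAddCommGroup E] [InnerProductSpace ℝ E]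
    (u : ℕ → E) {r : ℝ} (hr : 0 < r) {j n : ℕ} (hj : j ≤ n) :
    ‖∑ i ∈ Ioc 0 j, u i‖ ^ 2
      ≤ (r + 1) * ∑ i ∈ Ioc 0 n, ‖u i‖ ^ 2 + (1 / r) * ∑ i ∈ range n, ‖∑ l ∈ Ioc 0 i, u l‖ ^ 2 := by
  have key : ∀ j, ‖∑ i ∈ Ioc 0 j, u i‖ ^ 2
      ≤ (r + 1) * ∑ i ∈ Ioc 0 j, ‖u i‖ ^ 2
        + (1 / r) * ∑ i ∈ range j, ‖∑ l ∈ Ioc 0 i, u l‖ ^ 2 := by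
    intro j
    induction j with
    | zero => simp
    | succ j ih =>
      rw [sum_Ioc_succ_top (Nat.zero_le j), sum_Ioc_succ_top (Nat.zero_le j), sum_range_succ,
        norm_add_sq_real]
      set S := ∑ i ∈ Ioc 0 j, u i
      set y := u (j + 1)
      have h1 := (le_abs_self _).trans (abs_real_inner_le_norm S y)
      -- Weighted AM-GM with a free weight `r`; the increments of the squared norm then add up along
      -- `j`.
      have h2 : 2 * (‖S‖ * ‖y‖) ≤ r * ‖y‖ ^ 2 + 1 / r * ‖S‖ ^ 2 := by
        have : 0 ≤ 1 / r * (r * ‖y‖ - ‖S‖) ^ 2 := by positivity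
        have e : 1 / r * (r * ‖y‖ - ‖S‖) ^ 2
            = r * ‖y‖ ^ 2 - 2 * (‖S‖ * ‖y‖) + 1 / r * ‖S‖ ^ 2 := by
          field_simp; ring
        linarith
      linarith
  refine (key j).trans ?_
  gcongr

/-- Integrals of functions of `⌊l k⌋` are finite convex combinations. -/
theorem exists_integral_floor_eq (ν : Measure unitInterval) [IsProbabilityMeasure ν] (k : ℕ) :
    ∃ c : ℕ → ℝ, (∀ a, 0 ≤ c a) ∧ ∑ a ∈ range (k + 1), c a = 1 ∧
      ∀ g : ℕ → ℝ, ∫ l : unitInterval, g ⌊(l : ℝ) * (k : ℝ)⌋₊ ∂ν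
        = ∑ a ∈ range (k + 1), c a * g a := by
  set A : ℕ → Set unitInterval := fun a => (fun l : unitInterval => ⌊(l : ℝ) * (k : ℝ)⌋₊) ⁻¹' {a}
    with hA
  have hAm : ∀ a, MeasurableSet (A a) := fun a =>
    measurable_floor_mul k (MeasurableSet.singleton a)
  have hint : ∀ g : ℕ → ℝ, ∫ l : unitInterval, g ⌊(l : ℝ) * (k : ℝ)⌋₊ ∂ν
      = ∑ a ∈ range (k + 1), ν.real (A a) * g a := by
    intro g
    have h1 : ∀ l : unitInterval, g ⌊(l : ℝ) * (k : ℝ)⌋₊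
        = ∑ a ∈ range (k + 1), (A a).indicator (fun _ => g a) l := by
      intro l
      have hl : ⌊(l : ℝ) * (k : ℝ)⌋₊ ∈ range (k + 1) :=
        Finset.mem_range.2 (Nat.lt_succ_of_le (floor_mul_le l.2.2 k))
      rw [sum_eq_single_of_mem _ hl]
      · simp [hA]
      · intro b _ hb
        simp [hA, Set.indicator, hb.symm]
    simp_rw [h1]
    rw [integral_finsetSum _ fun a _ => (integrable_const _).indicator (hAm a)]
    refine sum_congr rfl fun a _ => ?_
    rw [integral_indicator_const _ (hAm a), smul_eq_mul]
  refine ⟨fun a => ν.real (A a), fun a => measureReal_nonneg, ?_, hint⟩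
  have := hint fun _ => 1
  simpa using this.symm

namespace IsCentredStationary

variable {Ω : Type*} [MeasurableSpace Ω] {p : ℕ} {P : Measure Ω} [IsProbabilityMeasure P]
  {U : ℤ → Ω → Fin p → ℝ}

theorem integrable_and_integral_linEnergy_le (hU : IsCentredStationary P U) (δ : Fin p → ℝ)
    {n m k₀ : ℕ} (hk₀ : k₀ ≤ n) (l : ℝ) (hl : l ≤ 1) :
    Integrable (fun ω => linEnergy n m k₀ (WithLp.toLp 2 δ) (fun i => WithLp.toLp 2 (U i ω)) l) P ∧
    ∫ ω, linEnergy n m k₀ (WithLp.toLp 2 δ) (fun i => WithLp.toLp 2 (U i ω)) l ∂P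
      ≤ 4 * (n ^ 3 * (∑' h : ℕ, spectralNorm (autocov P U h)) * ‖WithLp.toLp 2 δ‖ ^ 2) := by
  unfold linEnergy
  have h1 := floor_mul_le hl k₀
  have h2 := floor_mul_le hl (n - k₀)
  refine ⟨(hU.integrable_sq_inner_pairSum δ _ _ _).add (hU.integrable_sq_inner_pairSum δ _ _ _), ?_⟩
  rw [integral_add (hU.integrable_sq_inner_pairSum δ _ _ _)
    (hU.integrable_sq_inner_pairSum δ _ _ _)]
  have h3 := hU.integral_sq_inner_pairSum_le δ m (a := 0) (h1.trans hk₀)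
  have h4 := hU.integral_sq_inner_pairSum_le δ m (a := k₀) (n := n)
    (by omega : k₀ + ⌊l * ((n - k₀ : ℕ) : ℝ)⌋₊ ≤ n)
  linarith

/-- The ν-integral is a finite convex combination over the possible floors, so integrability in ω
and the exchange of integrals reduce to finite sums. -/
theorem integrable_and_integral_integral_linEnergy_le (hU : IsCentredStationary P U)
    (δ : Fin p → ℝ) {n m k₀ : ℕ} (hk₀ : k₀ ≤ n) (ν : Measure unitInterval)
    [IsProbabilityMeasure ν] :
    Integrable (fun ω => ∫ l : unitInterval,
      linEnergy n m k₀ (WithLp.toLp 2 δ) (fun i => WithLp.toLp 2 (U i ω)) l ∂ν) P ∧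
    ∫ ω, ∫ l : unitInterval,
        linEnergy n m k₀ (WithLp.toLp 2 δ) (fun i => WithLp.toLp 2 (U i ω)) l ∂ν ∂P
      ≤ 4 * (n ^ 3 * (∑' h : ℕ, spectralNorm (autocov P U h)) * ‖WithLp.toLp 2 δ‖ ^ 2) := by
  obtain ⟨c, hc0, hc1, hc⟩ := exists_integral_floor_eq ν k₀
  obtain ⟨c', hc0', hc1', hc'⟩ := exists_integral_floor_eq ν (n - k₀)
  set Y : ℕ → ℕ → Ω → ℝ := fun a b ω =>
    ⟪WithLp.toLp 2 δ, pairSum m a b fun i => WithLp.toLp 2 (U i ω)⟫ ^ 2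
  have hY : ∀ a b, Integrable (Y a b) P := fun a b => hU.integrable_sq_inner_pairSum δ m a b
  have hfloor : ∀ (k : ℕ) (f : ℕ → ℝ),
      Integrable (fun l : unitInterval => f ⌊(l : ℝ) * (k : ℝ)⌋₊) ν := fun k f =>
    integrable_comp_floor ν k f
  have e : ∀ ω, ∫ l : unitInterval,
      linEnergy n m k₀ (WithLp.toLp 2 δ) (fun i => WithLp.toLp 2 (U i ω)) l ∂ν
      = ∑ a ∈ range (k₀ + 1), c a * Y 0 a ω
        + ∑ b ∈ range (n - k₀ + 1), c' b * Y k₀ (k₀ + b) ω := fun ω => by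
    unfold linEnergy
    rw [integral_add (hfloor k₀ fun a => Y 0 a ω) (hfloor (n - k₀) fun b => Y k₀ (k₀ + b) ω)]
    rw [← hc fun a => Y 0 a ω, ← hc' fun b => Y k₀ (k₀ + b) ω]
  simp_rw [e]
  have i1 : Integrable (fun ω => ∑ a ∈ range (k₀ + 1), c a * Y 0 a ω) P :=
    integrable_finsetSum _ fun a _ => (hY _ _).const_mul _
  have i2 : Integrable (fun ω => ∑ b ∈ range (n - k₀ + 1), c' b * Y k₀ (k₀ + b) ω) P :=
    integrable_finsetSum _ fun a _ => (hY _ _).const_mul _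
  refine ⟨i1.add i2, ?_⟩
  rw [integral_add i1 i2, integral_finsetSum _ fun a _ => (hY _ _).const_mul _,
    integral_finsetSum _ fun a _ => (hY _ _).const_mul _]
  simp_rw [integral_const_mul]
  set Z := 2 * (n : ℝ) ^ 3 * (∑' h : ℕ, spectralNorm (autocov P U h)) * ‖WithLp.toLp 2 δ‖ ^ 2 with hZ
  have s1 : ∑ a ∈ range (k₀ + 1), c a * ∫ ω, Y 0 a ω ∂P ≤ ∑ a ∈ range (k₀ + 1), c a * Z := by
    refine sum_le_sum fun a ha => mul_le_mul_of_nonneg_left ?_ (hc0 a)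
    rw [Finset.mem_range] at ha
    exact hU.integral_sq_inner_pairSum_le δ m (by omega)
  have s2 : ∑ b ∈ range (n - k₀ + 1), c' b * ∫ ω, Y k₀ (k₀ + b) ω ∂P
      ≤ ∑ b ∈ range (n - k₀ + 1), c' b * Z := by
    refine sum_le_sum fun a ha => mul_le_mul_of_nonneg_left ?_ (hc0' a)
    rw [Finset.mem_range] at ha
    exact hU.integral_sq_inner_pairSum_le δ m (by omega)
  rw [← sum_mul, hc1, one_mul] at s1
  rw [← sum_mul, hc1', one_mul] at s2
  linarith

theorem integral_sq_inner_partial_sub_le (hU : IsCentredStationary P U) (δ : Fin p → ℝ)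
    (k k₀ : ℕ) :
    Integrable (fun ω => ⟪WithLp.toLp 2 δ, ∑ i ∈ Ioc 0 k, WithLp.toLp 2 (U i ω)
        - ∑ i ∈ Ioc 0 k₀, WithLp.toLp 2 (U i ω)⟫ ^ 2) P ∧
    ∫ ω, ⟪WithLp.toLp 2 δ, ∑ i ∈ Ioc 0 k, WithLp.toLp 2 (U i ω)
        - ∑ i ∈ Ioc 0 k₀, WithLp.toLp 2 (U i ω)⟫ ^ 2 ∂P
      ≤ 2 * |(k : ℝ) - k₀| * (∑' h : ℕ, spectralNorm (autocov P U h)) * ‖WithLp.toLp 2 δ‖ ^ 2 := by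
  have key : ∀ {a b : ℕ}, a ≤ b →
      Integrable (fun ω => ⟪WithLp.toLp 2 δ, ∑ i ∈ Ioc 0 b, WithLp.toLp 2 (U i ω)
        - ∑ i ∈ Ioc 0 a, WithLp.toLp 2 (U i ω)⟫ ^ 2) P ∧
      ∫ ω, ⟪WithLp.toLp 2 δ, ∑ i ∈ Ioc 0 b, WithLp.toLp 2 (U i ω)
        - ∑ i ∈ Ioc 0 a, WithLp.toLp 2 (U i ω)⟫ ^ 2 ∂P
      ≤ 2 * |(b : ℝ) - a| * (∑' h : ℕ, spectralNorm (autocov P U h))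
        * ‖WithLp.toLp 2 δ‖ ^ 2 := by
    intro a b hab
    have e : ∀ ω, ⟪WithLp.toLp 2 δ, ∑ i ∈ Ioc 0 b, WithLp.toLp 2 (U i ω)
        - ∑ i ∈ Ioc 0 a, WithLp.toLp 2 (U i ω)⟫
        = ∑ i ∈ Ioc a b, 1 * ⟪WithLp.toLp 2 δ, WithLp.toLp 2 (U i ω)⟫ := fun ω => by
      rw [sum_Ioc_zero_sub (fun i : ℕ => WithLp.toLp 2 (U i ω)) hab, inner_sum]
      simp_rw [one_mul]
    simp_rw [e]
    refine ⟨hU.integrable_sq_sum_inner δ (Ioc a b) fun _ => 1, ?_⟩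
    refine (hU.integral_sq_sum_inner_le δ (Ioc a b) (fun _ => 1) (V := 1) (by simp)).trans_eq ?_
    rw [Nat.card_Ioc, abs_of_nonneg (sub_nonneg.2 (Nat.cast_le.2 hab)), Nat.cast_sub hab]
    ring
  rcases le_total k₀ k with h | h
  · exact key h
  · have := key h
    rw [abs_sub_comm]
    refine ⟨?_, ?_⟩
    · refine this.1.congr (Eventually.of_forall fun ω => ?_)
      simp only
      rw [← inner_neg_neg, neg_sub, inner_neg_left, neg_sq]
    · refine le_of_eq_of_le (integral_congr_ae (Eventually.of_forall fun ω => ?_)) this.2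
      simp only
      rw [← inner_neg_neg, neg_sub, inner_neg_left, neg_sq]

variable {n m k₀ : ℕ} {γ θ ξ M : ℝ} {δ : Fin p → ℝ}

theorem measure_energy_le (hU : IsCentredStationary P U) (hn : 0 < n) (hγ : 0 < γ) (hM : 0 < M)
    (hδ : 0 < ‖WithLp.toLp 2 δ‖) {c : ℝ} (hc : (gammaBar P U).trace ≤ c * (γ * ‖WithLp.toLp 2 δ‖ ^ 2)) :
    P {ω | M * n * γ * ‖WithLp.toLp 2 δ‖ ^ 2 < ∑ i ∈ Ioc 0 n, ‖WithLp.toLp 2 (U i ω)‖ ^ 2}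
      ≤ ENNReal.ofReal (c / M) := by
  have hi : ∀ i : ℕ, Integrable (fun ω => ‖WithLp.toLp 2 (U i ω)‖ ^ 2) P := fun i => by
    simpa using hU.integrable_norm_sum_sq {i}
  refine measure_lt_le_of_integral_le (fun ω => sum_nonneg fun _ _ => sq_nonneg _)
    (integrable_finsetSum _ fun i _ => hi i) (by positivity)
    (b := n * (gammaBar P U).trace) ?_ ?_
  · rw [integral_finsetSum _ fun i _ => hi i]
    calc _ ≤ ∑ i ∈ Ioc 0 n, (gammaBar P U).trace := by
          refine sum_le_sum fun i _ => ?_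
          simpa using hU.integral_norm_sum_sq_le {i}
      _ = _ := by simp
  · calc _ ≤ n * (c * (γ * ‖WithLp.toLp 2 δ‖ ^ 2)) := by gcongr
      _ = _ := by field_simp

/-- With weight r = √n both parts of `norm_sum_sq_le_of_pos` have mean of order n^{3/2} tr Γ̄.
Against n² γ ‖δ‖₂² this leaves 1 / √n. -/
theorem measure_partialSum_le (hU : IsCentredStationary P U) (hn : 0 < n) (hγ : 0 < γ) (hξ : 0 < ξ)
    (hδ : 0 < ‖WithLp.toLp 2 δ‖) {c : ℝ} (hc : (gammaBar P U).trace ≤ c * (γ * ‖WithLp.toLp 2 δ‖ ^ 2)) :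
    P {ω | ¬ ∀ j ≤ n, ‖∑ i ∈ Ioc 0 j, WithLp.toLp 2 (U i ω)‖
        ≤ ξ * n * (√γ * ‖WithLp.toLp 2 δ‖)}
      ≤ ENNReal.ofReal (3 * c / (ξ ^ 2 * √n)) := by
  have hn' : (0 : ℝ) < n := by positivity
  have hr : 0 < √(n : ℝ) := by positivity
  have hr1 : 1 ≤ √(n : ℝ) := Real.one_le_sqrt.2 (by exact_mod_cast hn)
  have hrr : √(n : ℝ) * √n = n := Real.mul_self_sqrt hn'.le
  have hi : ∀ i : ℕ, Integrable (fun ω => ‖WithLp.toLp 2 (U i ω)‖ ^ 2) P := fun i => by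
    simpa using hU.integrable_norm_sum_sq {i}
  have hS : ∀ j : ℕ, Integrable (fun ω => ‖∑ i ∈ Ioc 0 j, WithLp.toLp 2 (U i ω)‖ ^ 2) P :=
    fun j => hU.integrable_norm_sum_sq _
  have ht := trace_nonneg P U
  set t := (gammaBar P U).trace
  set F : Ω → ℝ := fun ω => (√n + 1) * ∑ i ∈ Ioc 0 n, ‖WithLp.toLp 2 (U i ω)‖ ^ 2
    + (1 / √n) * ∑ i ∈ range n, ‖∑ l ∈ Ioc 0 i, WithLp.toLp 2 (U l ω)‖ ^ 2 with hF
  have hF0 : ∀ ω, 0 ≤ F ω := fun ω =>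
    add_nonneg (mul_nonneg (by positivity) (sum_nonneg fun _ _ => sq_nonneg _))
      (mul_nonneg (by positivity) (sum_nonneg fun _ _ => sq_nonneg _))
  have i1 : Integrable (fun ω => (√n + 1) * ∑ i ∈ Ioc 0 n, ‖WithLp.toLp 2 (U i ω)‖ ^ 2) P :=
    (integrable_finsetSum _ fun i _ => hi i).const_mul _
  have i2 : Integrable (fun ω => (1 / √n) * ∑ i ∈ range n,
      ‖∑ l ∈ Ioc 0 i, WithLp.toLp 2 (U l ω)‖ ^ 2) P :=
    (integrable_finsetSum _ fun i _ => hS i).const_mul _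
  have h1 : ∫ ω, F ω ∂P ≤ 3 * n * √n * t := by
    rw [hF, integral_add i1 i2, integral_const_mul, integral_const_mul,
      integral_finsetSum _ fun i _ => hi i, integral_finsetSum _ fun i _ => hS i]
    have s1 : ∑ i ∈ Ioc 0 n, ∫ ω, ‖WithLp.toLp 2 (U i ω)‖ ^ 2 ∂P ≤ n * t := by
      calc _ ≤ ∑ i ∈ Ioc 0 n, t := by
            refine sum_le_sum fun i _ => ?_
            simpa using hU.integral_norm_sum_sq_le {i}
        _ = _ := by simp
    have s2 : ∑ i ∈ range n, ∫ ω, ‖∑ l ∈ Ioc 0 i, WithLp.toLp 2 (U l ω)‖ ^ 2 ∂P ≤ n * (n * t) := by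
      calc _ ≤ ∑ i ∈ range n, n * t := by
            refine sum_le_sum fun i hi => ?_
            refine (hU.integral_norm_sum_sq_le _).trans ?_
            rw [Nat.card_Ioc, Nat.sub_zero]
            have : (i : ℝ) ≤ n := by exact_mod_cast (Finset.mem_range.1 hi).le
            gcongr
        _ = _ := by simp
    calc _ ≤ (√n + 1) * (n * t) + (1 / √n) * (n * (n * t)) := by gcongr
      _ = (√n + 1) * (n * t) + √n * (n * t) := by
          congr 1
          rw [one_div, inv_mul_eq_div, div_eq_iff hr.ne']
          calc (n : ℝ) * (n * t) = (√n * √n) * (n * t) := by rw [hrr]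
            _ = _ := by ring
      _ ≤ (√n + √n) * (n * t) + √n * (n * t) := by gcongr
      _ = _ := by ring
  refine (measure_mono ?_).trans (measure_lt_le_of_integral_le
    (t := (ξ * n * (√γ * ‖WithLp.toLp 2 δ‖)) ^ 2) hF0 (i1.add i2)
    (by positivity) h1 ?_)
  · intro ω hω
    simp only [Set.mem_ofPred_eq, not_forall, not_le] at hω ⊢
    obtain ⟨j, hj, hω⟩ := hω
    calc _ < ‖∑ i ∈ Ioc 0 j, WithLp.toLp 2 (U i ω)‖ ^ 2 := by gcongr
      _ ≤ _ := norm_sum_sq_le_of_pos (fun i : ℕ => WithLp.toLp 2 (U i ω)) hr hj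
  · calc 3 * n * √n * t ≤ 3 * n * √n * (c * (γ * ‖WithLp.toLp 2 δ‖ ^ 2)) := by gcongr
      _ = 3 * c / (ξ ^ 2 * √n) * (ξ ^ 2 * n * (√n * √n) * (γ * ‖WithLp.toLp 2 δ‖ ^ 2)) := by
          field_simp
      _ = 3 * c / (ξ ^ 2 * √n) * (ξ ^ 2 * n * n * (√γ ^ 2 * ‖WithLp.toLp 2 δ‖ ^ 2)) := by
          rw [hrr, Real.sq_sqrt hγ.le]
      _ = _ := by ring

/-- A union bound written as Markov's inequality for the sum of the normalized squares. Each term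
has mean of order 1 / |k - k₀| ≤ M / (θ² n γ), and at most 2n indices occur, so n cancels and the
smallness rests on `τ` alone. -/
theorem measure_increment_le (hU : IsCentredStationary P U) (hn : 0 < n) (hγ : 0 < γ)
    (hθ : 0 < θ) (hM : 0 < M) (hξ : 0 < ξ) (hδ : 0 < ‖WithLp.toLp 2 δ‖) {τ : ℝ}
    (hτ : ∑' h : ℕ, spectralNorm (autocov P U h) ≤ τ * (γ * ‖WithLp.toLp 2 δ‖ ^ 2)) :
    P {ω | ¬ ∀ k ≤ n, θ ^ 2 * n * γ < |(k : ℝ) - k₀| * M →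
      |⟪WithLp.toLp 2 δ, ∑ i ∈ Ioc 0 k, WithLp.toLp 2 (U i ω)
        - ∑ i ∈ Ioc 0 k₀, WithLp.toLp 2 (U i ω)⟫|
        ≤ ξ * |(k : ℝ) - k₀| * ‖WithLp.toLp 2 δ‖ ^ 2}
      ≤ ENNReal.ofReal (4 * M * τ / (θ ^ 2 * ξ ^ 2)) := by
  have hn' : (0 : ℝ) < n := by positivity
  have hn1 : (1 : ℝ) ≤ n := by exact_mod_cast hn
  set s := ∑' h : ℕ, spectralNorm (autocov P U h)
  have hs0 : 0 ≤ s := tsum_nonneg fun _ => spectralNorm_nonneg _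
  set t := ‖WithLp.toLp 2 δ‖
  set I := (range (n + 1)).filter fun k : ℕ => θ ^ 2 * n * γ < |(k : ℝ) - k₀| * M with hI
  set Y : ℕ → Ω → ℝ := fun k ω => ⟪WithLp.toLp 2 δ, ∑ i ∈ Ioc 0 k, WithLp.toLp 2 (U i ω)
        - ∑ i ∈ Ioc 0 k₀, WithLp.toLp 2 (U i ω)⟫ with hYdef
  have hY : ∀ k, Integrable (fun ω => Y k ω ^ 2) P ∧
      ∫ ω, Y k ω ^ 2 ∂P ≤ 2 * |(k : ℝ) - k₀| * s * t ^ 2 := fun k =>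
    hU.integral_sq_inner_partial_sub_le δ k k₀
  have hpos : ∀ k ∈ I, 0 < |(k : ℝ) - k₀| := fun k hk => by
    have h1 := (Finset.mem_filter.1 hk).2
    have h2 : 0 ≤ θ ^ 2 * n * γ := by positivity
    by_contra h
    nlinarith
  have h1 : ∫ ω, ∑ k ∈ I, Y k ω ^ 2 / |(k : ℝ) - k₀| ^ 2 ∂P ≤ 4 * s * t ^ 2 * M / (θ ^ 2 * γ) := by
    rw [integral_finsetSum _ fun k _ => (hY k).1.div_const _]
    calc _ ≤ ∑ k ∈ I, 2 * s * t ^ 2 * (M / (θ ^ 2 * n * γ)) := by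
          refine sum_le_sum fun k hk => ?_
          have hp := hpos k hk
          have hk2 := (Finset.mem_filter.1 hk).2
          rw [integral_div]
          calc _ ≤ 2 * |(k : ℝ) - k₀| * s * t ^ 2 / |(k : ℝ) - k₀| ^ 2 := by
                gcongr; exact (hY k).2
            _ = 2 * s * t ^ 2 * (1 / |(k : ℝ) - k₀|) := by field_simp
            _ ≤ _ := by
                gcongr 2 * s * t ^ 2 * ?_
                rw [div_le_div_iff₀ hp (by positivity)]
                linarith
      _ ≤ (2 * n) * (2 * s * t ^ 2 * (M / (θ ^ 2 * n * γ))) := by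
          rw [sum_const, nsmul_eq_mul]
          gcongr
          have h3 := card_filter_le (range (n + 1)) fun k : ℕ => θ ^ 2 * n * γ < |(k : ℝ) - k₀| * M
          rw [card_range] at h3
          calc (#I : ℝ) ≤ ((n + 1 : ℕ) : ℝ) := Nat.cast_le.2 h3
            _ ≤ 2 * n := by push_cast; linarith
      _ = _ := by field_simp; ring
  refine (measure_mono ?_).trans (measure_lt_le_of_integral_le
    (t := (ξ * t ^ 2) ^ 2) (fun ω => sum_nonneg fun k _ => by positivity)
    (integrable_finsetSum _ fun k _ => (hY k).1.div_const _) (by positivity) h1 ?_)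
  · intro ω hω
    simp only [Set.mem_ofPred_eq, not_forall, not_le] at hω ⊢
    obtain ⟨k, hk, hk2, hω⟩ := hω
    have hkI : k ∈ I := Finset.mem_filter.2 ⟨Finset.mem_range.2 (by omega), hk2⟩
    have hp := hpos k hkI
    calc (ξ * t ^ 2) ^ 2 < Y k ω ^ 2 / |(k : ℝ) - k₀| ^ 2 := by
          rw [lt_div_iff₀ (by positivity), ← mul_pow, ← sq_abs (Y k ω)]
          gcongr
          linarith
      _ ≤ _ := single_le_sum (f := fun k : ℕ => Y k ω ^ 2 / |(k : ℝ) - k₀| ^ 2)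
          (fun k _ => by positivity) hkI
  · calc 4 * s * t ^ 2 * M / (θ ^ 2 * γ)
        ≤ 4 * (τ * (γ * t ^ 2)) * t ^ 2 * M / (θ ^ 2 * γ) := by gcongr
      _ = _ := by field_simp

/-- The mean is of order n³ s ‖δ‖₂², with s the sum of spectral norms, and the threshold of order n⁴
γ² ‖δ‖₂⁴. One factor γ ‖δ‖₂² absorbs s, and the remaining 1 / (n γ) is bounded by 1 / c. -/
theorem measure_linear_le (hU : IsCentredStationary P U) (hn : 0 < n) (hk₀ : k₀ ≤ n) (hγ : 0 < γ)
    (hθ : 0 < θ) (hδ : 0 < ‖WithLp.toLp 2 δ‖) (ν : Measure unitInterval) [IsProbabilityMeasure ν]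
    {τ c : ℝ} (hc : 0 < c) (hcn : c ≤ n * γ) (hτ0 : 0 ≤ τ)
    (hτ : ∑' h : ℕ, spectralNorm (autocov P U h) ≤ τ * (γ * ‖WithLp.toLp 2 δ‖ ^ 2)) :
    P {ω | n ^ 4 * (θ * γ * ‖WithLp.toLp 2 δ‖ ^ 2) ^ 2 < ∫ l : unitInterval,
          linEnergy n m k₀ (WithLp.toLp 2 δ) (fun i => WithLp.toLp 2 (U i ω)) l ∂ν
        + linEnergy n m k₀ (WithLp.toLp 2 δ) (fun i => WithLp.toLp 2 (U i ω)) 1}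
      ≤ ENNReal.ofReal (8 * τ / (c * θ ^ 2)) := by
  have hn' : (0 : ℝ) < n := by positivity
  obtain ⟨i1, b1⟩ := hU.integrable_and_integral_integral_linEnergy_le δ (m := m) hk₀ ν
  obtain ⟨i2, b2⟩ := hU.integrable_and_integral_linEnergy_le δ (m := m) hk₀ 1 le_rfl
  refine measure_lt_le_of_integral_le (fun ω => ?_) (i1.add i2) (by positivity)
    (b := 8 * (n ^ 3 * (∑' h : ℕ, spectralNorm (autocov P U h)) * ‖WithLp.toLp 2 δ‖ ^ 2)) ?_ ?_
  · exact add_nonneg (integral_nonneg fun l => linEnergy_nonneg _ _ _ _ _ _)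
      (linEnergy_nonneg _ _ _ _ _ _)
  · rw [integral_add' i1 i2]
    linarith
  · set t := ‖WithLp.toLp 2 δ‖
    calc _ ≤ 8 * (n ^ 3 * (τ * (γ * t ^ 2)) * t ^ 2) := by gcongr
      _ = 8 * τ / (c * θ ^ 2) * (n ^ 3 * c * θ ^ 2 * γ * t ^ 4) := by field_simp
      _ ≤ 8 * τ / (c * θ ^ 2) * (n ^ 3 * (n * γ) * θ ^ 2 * γ * t ^ 4) := by gcongr
      _ = _ := by ring

/-- With high probability the noise is small. -/
theorem measure_not_isSmallNoise_le (hU : IsCentredStationary P U) (hn : 0 < n) (hk₀ : k₀ ≤ n)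
    (hγ : 0 < γ) (hθ : 0 < θ) (hM : 0 < M) (hξ : 0 < ξ) (hδ : 0 < ‖WithLp.toLp 2 δ‖)
    (ν : Measure unitInterval) [IsProbabilityMeasure ν] {c₁ c₂ τ : ℝ}
    (hc₁ : (gammaBar P U).trace ≤ c₁ * (γ * ‖WithLp.toLp 2 δ‖ ^ 2))
    (hc₂ : 0 < c₂) (hcn : c₂ ≤ n * γ) (hτ0 : 0 ≤ τ)
    (hτ : ∑' h : ℕ, spectralNorm (autocov P U h) ≤ τ * (γ * ‖WithLp.toLp 2 δ‖ ^ 2)) :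
    P {ω | ¬ IsSmallNoise ν n m k₀ γ θ ξ M (WithLp.toLp 2 δ) fun i => WithLp.toLp 2 (U i ω)}
      ≤ ENNReal.ofReal (c₁ / M) + ENNReal.ofReal (3 * c₁ / (ξ ^ 2 * √n))
        + ENNReal.ofReal (4 * M * τ / (θ ^ 2 * ξ ^ 2)) + ENNReal.ofReal (8 * τ / (c₂ * θ ^ 2)) := by
  have h1 := hU.measure_energy_le hn hγ hM hδ hc₁
  have h2 := hU.measure_partialSum_le hn hγ hξ hδ hc₁
  have h3 := hU.measure_increment_le (k₀ := k₀) hn hγ hθ hM hξ hδ hτ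
  have h4 := hU.measure_linear_le (m := m) hn hk₀ hγ hθ hδ ν hc₂ hcn hτ0 hτ
  refine le_trans ?_ (add_le_add (add_le_add (add_le_add h1 h2) h3) h4)
  refine (measure_mono ?_).trans ((measure_union_le _ _).trans (add_le_add
    ((measure_union_le _ _).trans (add_le_add (measure_union_le _ _) le_rfl)) le_rfl))
  intro ω hω
  by_contra h
  simp only [Set.mem_union, Set.mem_ofPred_eq, not_or, not_lt, not_not] at h
  exact hω ⟨h.1.1.1, h.1.1.2, h.1.2, h.2⟩

end IsCentredStationary

/-! ### Consistency of the test -/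

theorem IsErrorModel.isCentredStationary {Ω S : Type*} [MeasurableSpace Ω] [MeasurableSpace S]
    {p : ℕ} {P : Measure Ω} {k₀ : ℕ} {ε : ℤ → Ω → S} {f₁ f₂ : (ℕ → S) → Fin p → ℝ}
    (h : IsErrorModel P k₀ ε f₁ f₂)
    (hs : Summable fun h : ℕ => spectralNorm (autocov P (noise k₀ ε f₁ f₂) h)) :
    IsCentredStationary P (noise k₀ ε f₁ f₂) where
  memLp j a := by
    unfold noise
    split_ifs
    · exact h.memLp_eta j a
    · exact h.memLp_rho j a
  centred j a := by
    unfold noise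
    split_ifs
    · exact h.centred_eta j a
    · exact h.centred_rho j a
  stationary := h.stationary
  summable := hs

/-- If the noise is small, the statistic estimates the size of the change and the self-normalizer
is negligible. -/
theorem IsSmallNoise.abs_stat_sub_le {p n m k₀ k : ℕ} {γ θ ξ M κ : ℝ} {μ δ : Fin p → ℝ}
    {x w : ℕ → Fin p → ℝ} {ν : Measure unitInterval} [IsProbabilityMeasure ν]
    (hp : 0 < p) (hκ : 0 < κ) (h1 : κ * n ≤ k₀) (h2 : κ * n ≤ n - k₀) (hn : 0 < n)
    (hγ0 : 0 ≤ γ) (hγ1 : γ ≤ 1) (hθ0 : 0 < θ) (hθ1 : θ ≤ 1) (hθκ : θ ^ 2 ≤ κ / 2) (hM : 1 ≤ M)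
    (hξ0 : 0 ≤ ξ) (hξθ : ξ ≤ θ) (hξ : 16 * ξ * M < κ ^ 3 * θ)
    (hm : (2 * m + 1) * (4 * M) ≤ θ * n) (hmκ : 4 * (2 * m + 1) ≤ κ * n)
    (hδ : 0 < ‖WithLp.toLp 2 δ‖)
    (hw : IsSmallNoise ν n m k₀ γ θ ξ M (WithLp.toLp 2 δ) fun i => WithLp.toLp 2 (w i))
    (hx : ∀ i, x i = μ + w i + if i ≤ k₀ then 0 else δ) (hk : IsChangePointEstimate n x k) :
    |stat n m k x - normSq δ| ≤ 204 * (64 / κ ^ 4) * θ * γ * normSq δ ∧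
      selfNormalizer ν n m k x ≤ 204 * (64 / κ ^ 4) * θ * γ * normSq δ := by
  have hn' : (0 : ℝ) < n := by positivity
  have hκn : 0 < κ * n := by positivity
  have hk₀ : k₀ ≤ n := by
    have : (k₀ : ℝ) ≤ n := by linarith
    exact_mod_cast this
  have hk₀1 : 1 ≤ k₀ := by
    have : (0 : ℝ) < k₀ := by linarith
    exact_mod_cast this
  obtain ⟨hkmem, hkmax⟩ := hk
  rw [Finset.mem_Icc] at hkmem
  have hmax := hkmax k₀ (Finset.mem_Icc.2 ⟨hk₀1, hk₀⟩)
  rw [cusumSq_eq hk₀1 hk₀, cusumSq_eq hkmem.1 hkmem.2,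
    div_le_div_iff_of_pos_right (by positivity), sq_le_sq₀ (norm_nonneg _) (norm_nonneg _)] at hmax
  have hR := abs_sub_le_of_norm_cusum_le hκ hn hkmem.2 hk₀ h1 h2 hγ0 hγ1 hθ0 hθ1 hM hξ0
    (hξθ.trans hθ1) hξ (fun i => WithLp.toLp 2 (x i)) (fun i => WithLp.toLp 2 (w i))
    (WithLp.toLp 2 μ) (WithLp.toLp 2 δ) hδ
    (fun i => by
      rw [hx i, WithLp.toLp_add, WithLp.toLp_add]
      split_ifs <;> simp) hw.energy hw.partialSum (hw.increment k hkmem.2) hmax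
  refine abs_stat_sub_le_and_selfNormalizer_le hp hκ h1 h2 hn hkmem.2 hk₀ hγ0 hγ1 hθ0.le hθ1 hθκ
    hM hm hmκ hR hw.energy (fun j hj => (hw.partialSum j hj).trans ?_) hx ν hw.linear
  gcongr

/-! ### Asymptotics of the trimming and of the change location. -/

theorem isLittleO_of_rpow_isLittleO {m : ℕ → ℕ}
    (hmn : (fun n => (m n : ℝ) ^ (3 / 2 : ℝ)) =o[atTop] fun n => (n : ℝ)) :
    (fun n => (m n : ℝ)) =o[atTop] fun n => (n : ℝ) := by
  refine IsBigO.trans_isLittleO (IsBigO.of_bound 1 (Eventually.of_forall fun n => ?_)) hmn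
  rw [one_mul, Real.norm_natCast, Real.norm_of_nonneg (by positivity)]
  rcases Nat.eq_zero_or_pos (m n) with h | h
  · rw [h]; simp
  · exact Real.self_le_rpow_of_one_le (by exact_mod_cast h) (by norm_num)

theorem eventually_two_mul_add_one_le {m : ℕ → ℕ}
    (hmn : (fun n => (m n : ℝ)) =o[atTop] fun n => (n : ℝ)) {c : ℝ} (hc : 0 < c) :
    ∀ᶠ n : ℕ in atTop, 2 * (m n : ℝ) + 1 ≤ c * n := by
  have h1 := hmn.bound (by positivity : 0 < c / 4)
  have h2 : ∀ᶠ n : ℕ in atTop, 2 / c ≤ (n : ℝ) :=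
    tendsto_natCast_atTop_atTop.eventually_ge_atTop _
  filter_upwards [h1, h2] with n h1 h2
  rw [Real.norm_natCast, Real.norm_natCast] at h1
  rw [div_le_iff₀ hc] at h2
  linarith

theorem eventually_le_floor_mul {ϑ : ℝ} (hϑ : ϑ ∈ Set.Ioo (0 : ℝ) 1) :
    ∀ᶠ n : ℕ in atTop, min ϑ (1 - ϑ) / 2 * n ≤ ⌊(n : ℝ) * ϑ⌋₊ ∧
      min ϑ (1 - ϑ) / 2 * n ≤ n - ⌊(n : ℝ) * ϑ⌋₊ := by
  have h2 : ∀ᶠ n : ℕ in atTop, 2 / ϑ ≤ (n : ℝ) :=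
    tendsto_natCast_atTop_atTop.eventually_ge_atTop _
  filter_upwards [h2] with n hn
  rw [div_le_iff₀ hϑ.1] at hn
  have hn0 : (0 : ℝ) ≤ n := Nat.cast_nonneg n
  have h3 := Nat.lt_floor_add_one ((n : ℝ) * ϑ)
  have h4 := Nat.floor_le (mul_nonneg hn0 hϑ.1.le)
  have h5 : min ϑ (1 - ϑ) * n ≤ ϑ * n := by gcongr; exact min_le_left _ _
  have h6 : min ϑ (1 - ϑ) * n ≤ (1 - ϑ) * n := by gcongr; exact min_le_right _ _
  have h7 : 0 ≤ (1 - ϑ) * n := mul_nonneg (by linarith [hϑ.2]) hn0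
  constructor <;> linarith

theorem frobNorm_nonneg {p : ℕ} (A : Matrix (Fin p) (Fin p) ℝ) : 0 ≤ frobNorm A :=
  Real.sqrt_nonneg _

/-- Uniformly over the signals that dominate the noise level, the statistic estimates the size of
the change and the self-normalizer is negligible. -/
theorem eventually_measure_stat_sub_le {Ω : ℕ → Type*} [∀ n, MeasurableSpace (Ω n)]
    (P : ∀ n, Measure (Ω n)) [∀ n, IsProbabilityMeasure (P n)]
    (p : ℕ → ℕ) (hp : ∀ n, 1 ≤ p n) (ϑ₀ : ℝ) (hϑ₀ : ϑ₀ ∈ Set.Ioo (0 : ℝ) 1)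
    (k₀ : ℕ → ℕ) (hk₀ : ∀ n, k₀ n = ⌊(n : ℝ) * ϑ₀⌋₊)
    (U : ∀ n, ℤ → Ω n → Fin (p n) → ℝ) (hU : ∀ n, IsCentredStationary (P n) (U n))
    (μ : ∀ n, Fin (p n) → ℝ) (ν : Measure unitInterval) [IsProbabilityMeasure ν] (m : ℕ → ℕ)
    (khat : ∀ n, (Fin (p n) → ℝ) → Ω n → ℕ)
    (hkhat : ∀ n, 1 ≤ n → ∀ δ ω,
      IsChangePointEstimate n (obs (μ n) δ (k₀ n) (U n) ω) (khat n δ ω))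
    (hspectral : (fun n => ∑' h : ℕ, spectralNorm (autocov (P n) (U n) h))
      =o[atTop] fun n => frobNorm (gammaBar (P n) (U n)))
    (htrace : (fun n => (gammaBar (P n) (U n)).trace ^ 2)
      =O[atTop] fun n => frobNorm (gammaBar (P n) (U n)) ^ 2)
    (hmn : (fun n => (m n : ℝ)) =o[atTop] fun n => (n : ℝ))
    (hnoise : (fun n => (p n : ℝ)) =O[atTop] fun n => (n : ℝ) * frobNorm (gammaBar (P n) (U n)))
    {c₁ ζ η : ℝ} (hc₁ : 0 < c₁) (hζ : 0 < ζ) (hη : 0 < η) :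
    ∀ᶠ n in atTop, 0 < frobNorm (gammaBar (P n) (U n)) ∧ ∀ δ : Fin (p n) → ℝ,
      c₁ ≤ normSq δ → c₁ * (frobNorm (gammaBar (P n) (U n)) / p n) ≤ normSq δ →
      P n {ω | ¬ (|stat n (m n) (khat n δ ω) (obs (μ n) δ (k₀ n) (U n) ω) - normSq δ|
          ≤ ζ * (min 1 (frobNorm (gammaBar (P n) (U n)) / p n) * normSq δ) ∧
        selfNormalizer ν n (m n) (khat n δ ω) (obs (μ n) δ (k₀ n) (U n) ω)
          ≤ ζ * (min 1 (frobNorm (gammaBar (P n) (U n)) / p n) * normSq δ))}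
        ≤ ENNReal.ofReal η := by
  set κ : ℝ := min ϑ₀ (1 - ϑ₀) / 2 with hκdef
  have hκ : 0 < κ := by
    have : 0 < min ϑ₀ (1 - ϑ₀) := lt_min hϑ₀.1 (by linarith [hϑ₀.2])
    positivity
  have hκ1 : κ ≤ 1 := by
    have : min ϑ₀ (1 - ϑ₀) ≤ ϑ₀ := min_le_left _ _
    linarith [hϑ₀.2]
  obtain ⟨cF, hcF0, htr⟩ : ∃ cF : ℝ, 0 < cF ∧ ∀ᶠ n in atTop,
      (gammaBar (P n) (U n)).trace ≤ cF * frobNorm (gammaBar (P n) (U n)) := by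
    obtain ⟨c, hc0, hc⟩ := htrace.exists_pos
    refine ⟨√c, Real.sqrt_pos.2 hc0, hc.bound.mono fun n hn => ?_⟩
    rw [Real.norm_of_nonneg (sq_nonneg _), Real.norm_of_nonneg (sq_nonneg _)] at hn
    refine (abs_le_of_sq_le_sq' ?_ (mul_nonneg (Real.sqrt_nonneg _) (frobNorm_nonneg _))).2
    rwa [mul_pow, Real.sq_sqrt hc0.le]
  obtain ⟨cp, hcp0, hcp⟩ := hnoise.exists_pos
  set K : ℝ := 204 * (64 / κ ^ 4) with hK
  have hK0 : 0 < K := by positivity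
  -- The constants depend on each other in this order: `θ` on the accuracy `ζ`, `M` on the
  -- probability `η`, `ξ` on `θ` and `M`, and `τ` on all of these. Each of the four failure
  -- probabilities gets η / 4.
  obtain ⟨θ, hθ0, hθ1, hθκ, hθK⟩ : ∃ θ : ℝ, 0 < θ ∧ θ ≤ 1 ∧ θ ^ 2 ≤ κ / 2 ∧ K * θ ≤ ζ := by
    refine ⟨min 1 (min (κ / 2) (ζ / K)), by positivity, min_le_left _ _, ?_, ?_⟩
    · have h1 : min 1 (min (κ / 2) (ζ / K)) ≤ 1 := min_le_left _ _
      have h2 : min 1 (min (κ / 2) (ζ / K)) ≤ κ / 2 := (min_le_right _ _).trans (min_le_left _ _)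
      have h3 : 0 < min 1 (min (κ / 2) (ζ / K)) := by positivity
      nlinarith
    · have h2 : min 1 (min (κ / 2) (ζ / K)) ≤ ζ / K := (min_le_right _ _).trans (min_le_right _ _)
      calc _ ≤ K * (ζ / K) := by gcongr
        _ = ζ := by field_simp
  set c : ℝ := cF / c₁ with hcdef
  have hc0 : 0 < c := by positivity
  obtain ⟨M, hM, hMη⟩ : ∃ M : ℝ, 1 ≤ M ∧ c / M ≤ η / 4 := by
    refine ⟨max 1 (4 * c / η), le_max_left _ _, ?_⟩
    rw [div_le_iff₀ (by positivity)]
    calc c = η / 4 * (4 * c / η) := by field_simp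
      _ ≤ _ := by gcongr; exact le_max_right _ _
  set ξ : ℝ := κ ^ 3 * θ / (17 * M) with hξdef
  have hξ0 : 0 < ξ := by positivity
  have hξM : 17 * ξ * M = κ ^ 3 * θ := by rw [hξdef]; field_simp
  have hξ : 16 * ξ * M < κ ^ 3 * θ := by
    have : 0 < ξ * M := by positivity
    linarith
  have hξθ : ξ ≤ θ := by
    have h1 : κ ^ 3 * θ ≤ 1 * θ := by gcongr; exact pow_le_one₀ hκ.le hκ1
    have h2 : ξ * 1 ≤ ξ * M := by gcongr
    nlinarith
  set c₂ : ℝ := min 1 (1 / cp) with hc₂def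
  have hc₂ : 0 < c₂ := by positivity
  obtain ⟨τ, hτ0, hτ1, hτ2⟩ : ∃ τ : ℝ, 0 < τ ∧ 4 * M * τ / (θ ^ 2 * ξ ^ 2) ≤ η / 4 ∧
      8 * τ / (c₂ * θ ^ 2) ≤ η / 4 := by
    refine ⟨min (η / 4 * (θ ^ 2 * ξ ^ 2) / (4 * M)) (η / 4 * (c₂ * θ ^ 2) / 8), by positivity, ?_, ?_⟩
    · rw [div_le_iff₀ (by positivity)]
      calc _ ≤ 4 * M * (η / 4 * (θ ^ 2 * ξ ^ 2) / (4 * M)) := by gcongr; exact min_le_left _ _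
        _ = _ := by field_simp
    · rw [div_le_iff₀ (by positivity)]
      calc _ ≤ 8 * (η / 4 * (c₂ * θ ^ 2) / 8) := by gcongr; exact min_le_right _ _
        _ = _ := by ring
  have ev1 := eventually_le_floor_mul hϑ₀
  have ev2 := eventually_two_mul_add_one_le hmn (by positivity : 0 < θ / (4 * M))
  have ev3 := eventually_two_mul_add_one_le hmn (by positivity : 0 < κ / 4)
  have ev4 := hspectral.bound (by positivity : 0 < τ * c₁)
  have ev5 : ∀ᶠ n : ℕ in atTop, (12 * c / (ξ ^ 2 * η)) ^ 2 ≤ (n : ℝ) :=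
    tendsto_natCast_atTop_atTop.eventually_ge_atTop _
  filter_upwards [ev1, ev2, ev3, ev4, ev5, htr, hcp.bound, eventually_ge_atTop 1]
    with n ev1 ev2 ev3 ev4 ev5 htr hcp hn
  rw [← hk₀, ← hκdef] at ev1
  have hn' : (0 : ℝ) < n := by exact_mod_cast hn
  have hp' : (0 : ℝ) < p n := by exact_mod_cast hp n
  set F := frobNorm (gammaBar (P n) (U n)) with hF
  have hF0 : 0 ≤ F := frobNorm_nonneg _
  rw [Real.norm_natCast, Real.norm_of_nonneg (by positivity)] at hcp
  -- If ‖Γ̄‖_F were 0, the bound p ≤ cp · n ‖Γ̄‖_F would contradict p ≥ 1.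
  have hFpos : 0 < F := by
    refine hF0.lt_of_ne fun h => ?_
    rw [← h] at hcp
    simp only [mul_zero] at hcp
    linarith
  rw [Real.norm_of_nonneg (tsum_nonneg fun _ => spectralNorm_nonneg _),
    Real.norm_of_nonneg hF0] at ev4
  refine ⟨hFpos, fun δ hδ1 hδ2 => ?_⟩
  set g := F / p n with hg
  have hg0 : 0 < g := by positivity
  set γ := min 1 g with hγ
  have hγ0 : 0 < γ := by positivity
  have hγ1 : γ ≤ 1 := min_le_left _ _
  have hD0 : 0 < normSq δ := hc₁.trans_le hδ1
  have hnorm : ‖WithLp.toLp 2 δ‖ ^ 2 = p n * normSq δ := by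
    rw [normSq_eq]; field_simp
  have hδ : 0 < ‖WithLp.toLp 2 δ‖ := by
    refine (norm_nonneg _).lt_of_ne fun h => ?_
    rw [← h, zero_pow two_ne_zero] at hnorm
    exact (mul_pos hp' hD0).ne hnorm
  -- Each branch of the minimum uses one of the two lower bounds on `normSq δ`.
  have hgD : c₁ * g ≤ γ * normSq δ := by
    rcases le_total 1 g with h | h
    · rw [hγ, min_eq_left h, one_mul]; exact hδ2
    · rw [hγ, min_eq_right h, mul_comm]; gcongr
  have hFD : c₁ * F ≤ γ * ‖WithLp.toLp 2 δ‖ ^ 2 := by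
    have : F = p n * g := by rw [hg]; field_simp
    rw [hnorm, this]
    calc c₁ * (p n * g) = p n * (c₁ * g) := by ring
      _ ≤ p n * (γ * normSq δ) := by gcongr
      _ = _ := by ring
  have htr' : (gammaBar (P n) (U n)).trace ≤ c * (γ * ‖WithLp.toLp 2 δ‖ ^ 2) := by
    calc _ ≤ cF * F := htr
      _ = c * (c₁ * F) := by rw [hcdef]; field_simp
      _ ≤ _ := by gcongr
  have hs : ∑' h : ℕ, spectralNorm (autocov (P n) (U n) h) ≤ τ * (γ * ‖WithLp.toLp 2 δ‖ ^ 2) := by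
    calc _ ≤ τ * c₁ * F := ev4
      _ = τ * (c₁ * F) := by ring
      _ ≤ _ := by gcongr
  -- n γ = min n (n g), where n ≥ 1 and n g ≥ 1 / cp by the lower bound on the noise level.
  have hcn : c₂ ≤ n * γ := by
    have h1 : 1 / cp ≤ n * g := by
      rw [hg, div_le_iff₀ hcp0, mul_div_assoc', div_mul_eq_mul_div, one_le_div hp']
      linarith
    rcases le_total 1 g with h | h
    · rw [hγ, min_eq_left h, mul_one]
      exact (min_le_left _ _).trans (by exact_mod_cast hn)
    · rw [hγ, min_eq_right h]
      exact (min_le_right _ _).trans h1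
  have hk₀n : k₀ n ≤ n := by
    have : (k₀ n : ℝ) ≤ n := by linarith [ev1.2, (by positivity : 0 < κ * (n : ℝ))]
    exact_mod_cast this
  have hbad := (hU n).measure_not_isSmallNoise_le (m := m n) (θ := θ) (ξ := ξ) (M := M) hn hk₀n hγ0
    hθ0 (by linarith) hξ0 hδ ν htr' hc₂ hcn hτ0.le hs
  have h5 : 3 * c / (ξ ^ 2 * √n) ≤ η / 4 := by
    have h6 : 12 * c / (ξ ^ 2 * η) ≤ √n := Real.le_sqrt_of_sq_le ev5
    rw [div_le_iff₀ (by positivity)] at h6 ⊢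
    linarith
  refine (measure_mono ?_).trans (hbad.trans ?_)
  · intro ω hω hsmall
    refine hω ?_
    have := hsmall.abs_stat_sub_le (κ := κ) (μ := μ n) (x := obs (μ n) δ (k₀ n) (U n) ω)
      (k := khat n δ ω) (hp n) hκ ev1.1 ev1.2 hn hγ0.le hγ1 hθ0 hθ1 hθκ hM hξ0.le hξθ hξ
      (by rwa [div_mul_eq_mul_div, le_div_iff₀ (by positivity)] at ev2) (by linarith) hδ
      (fun i => rfl) (hkhat n hn δ ω)
    have hle : K * θ * γ * normSq δ ≤ ζ * (γ * normSq δ) := by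
      calc _ = K * θ * (γ * normSq δ) := by ring
        _ ≤ _ := by gcongr
    exact ⟨this.1.trans hle, this.2.trans hle⟩
  · rw [← ENNReal.ofReal_add (by positivity) (by positivity),
      ← ENNReal.ofReal_add (by positivity) (by positivity),
      ← ENNReal.ofReal_add (by positivity) (by positivity)]
    refine ENNReal.ofReal_le_ofReal ?_
    linarith

/-- Here D is unbounded, so the error relative to D is beaten in two ways: by the gap D - Δ ≥ D / 2
when D ≥ 2Δ, and by the gap g ≥ γ otherwise. The absolute value of `q` covers quantiles of either
sign. -/
theorem rejects_of_mem_alternatives {p n m k : ℕ} {ν : Measure unitInterval} {x : ℕ → Fin p → ℝ}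
    {δ : Fin p → ℝ} {q Δ ζ g γ : ℝ} (hΔ : 0 < Δ) (hγ0 : 0 < γ) (hγ1 : γ ≤ 1) (hγg : γ ≤ g)
    (hζ0 : 0 ≤ ζ) (hζ1 : ζ * (1 + |q|) < 1 / 2) (hζΔ : ζ * (1 + |q|) * (2 * Δ) < 1)
    (hδ : Δ + g < normSq δ)
    (h1 : |stat n m k x - normSq δ| ≤ ζ * (γ * normSq δ))
    (h2 : selfNormalizer ν n m k x ≤ ζ * (γ * normSq δ)) : Rejects ν q Δ n m k x := by
  have hV : 0 ≤ selfNormalizer ν n m k x := Real.sqrt_nonneg _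
  have hq : q * selfNormalizer ν n m k x ≤ |q| * (ζ * (γ * normSq δ)) := by
    gcongr
    exact le_abs_self q
  rw [Rejects]
  set D := normSq δ
  have h3 := (abs_le.1 h1).1
  have hD : 0 < D := by linarith
  have hγD : 0 < γ * D := by positivity
  have key : ζ * (1 + |q|) * (γ * D) < D - Δ := by
    have hz : 0 ≤ ζ * (1 + |q|) := by positivity
    rcases le_total (2 * Δ) D with h | h
    · calc _ < 1 / 2 * (γ * D) := by gcongr
        _ ≤ 1 / 2 * (1 * D) := by gcongr
        _ ≤ _ := by linarith
    · calc _ ≤ ζ * (1 + |q|) * (γ * (2 * Δ)) := by gcongr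
        _ = ζ * (1 + |q|) * (2 * Δ) * γ := by ring
        _ ≤ 1 * γ := by gcongr
        _ < _ := by linarith
  linarith

/-- Under the null D < 2Δ, so the error is at most γ ≤ g < Δ - D. -/
theorem not_rejects_of_mem_nulls {p n m k : ℕ} {ν : Measure unitInterval} {x : ℕ → Fin p → ℝ}
    {δ : Fin p → ℝ} {q Δ ζ g γ : ℝ} (hΔ : 0 < Δ) (hγ0 : 0 < γ) (hγg : γ ≤ g)
    (hζ0 : 0 ≤ ζ) (hζΔ : ζ * (1 + |q|) * (2 * Δ) < 1) (hδ : normSq δ < Δ - g)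
    (h1 : |stat n m k x - normSq δ| ≤ ζ * (γ * normSq δ))
    (h2 : selfNormalizer ν n m k x ≤ ζ * (γ * normSq δ)) : ¬ Rejects ν q Δ n m k x := by
  have hV : 0 ≤ selfNormalizer ν n m k x := Real.sqrt_nonneg _
  have hq : -q * selfNormalizer ν n m k x ≤ |q| * (ζ * (γ * normSq δ)) := by
    gcongr
    exact neg_le_abs q
  rw [Rejects, not_lt]
  set D := normSq δ
  have h3 := (abs_le.1 h1).2
  have key : ζ * (1 + |q|) * (γ * D) ≤ Δ - D := by
    calc _ ≤ ζ * (1 + |q|) * (γ * (2 * Δ)) := by gcongr; linarith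
      _ = ζ * (1 + |q|) * (2 * Δ) * γ := by ring
      _ ≤ 1 * γ := by gcongr
      _ ≤ _ := by linarith
  linarith

/-- Needed for the upper bound on the liminf: in `ℝ≥0∞` the infimum over an empty set would be ∞. -/
theorem alternatives_nonempty {p : ℕ} (hp : 1 ≤ p) (Δ : ℝ) (G : Matrix (Fin p) (Fin p) ℝ) :
    (alternatives Δ G).Nonempty := by
  refine ⟨fun _ => √(|Δ + frobNorm G / p| + 1), ?_⟩
  have hp' : (p : ℝ) ≠ 0 := by positivity
  have h : normSq (fun _ : Fin p => √(|Δ + frobNorm G / p| + 1)) = |Δ + frobNorm G / p| + 1 := by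
    have h0 : 0 ≤ |Δ + frobNorm G / p| + 1 := by positivity
    simp only [normSq, Real.sq_sqrt h0, sum_const, card_univ, Fintype.card_fin, nsmul_eq_mul]
    field_simp
  change _ < normSq _
  rw [h]
  linarith [le_abs_self (Δ + frobNorm G / p)]

end RelevantChange

/-! ### Conclusion for alternatives and nulls. -/

open RelevantChange in
theorem theorem4p5
    -- dimensions, probability spaces, innovations and error processes for each sample size `n`
    {Ω S : ℕ → Type*} [∀ n, MeasurableSpace (Ω n)] [∀ n, MeasurableSpace (S n)]
    (P : ∀ n, Measure (Ω n)) [∀ n, IsProbabilityMeasure (P n)]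
    (p : ℕ → ℕ) (hp : ∀ n, 1 ≤ p n)
    (ϑ₀ : ℝ) (hϑ₀ : ϑ₀ ∈ Set.Ioo (0 : ℝ) 1)
    (k₀ : ℕ → ℕ) (hk₀ : ∀ n, k₀ n = ⌊(n : ℝ) * ϑ₀⌋₊)
    (ε : ∀ n, ℤ → Ω n → S n) (f₁ f₂ : ∀ n, (ℕ → S n) → Fin (p n) → ℝ)
    (hmodel : ∀ n, IsErrorModel (P n) (k₀ n) (ε n) (f₁ n) (f₂ n))
    (U : ∀ n, ℤ → Ω n → Fin (p n) → ℝ)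
    (hU : ∀ n, U n = noise (k₀ n) (ε n) (f₁ n) (f₂ n))
    (μ : ∀ n, Fin (p n) → ℝ)
    -- the test: threshold, level, self-normalization measure, quantile of the limit, trimming
    (Δ : ℝ) (hΔ : 0 < Δ) (C : ℝ) (hC : 0 < C)
    (α : ℝ) (hα : α ∈ Set.Ioo (0 : ℝ) 1)
    (ν : Measure unitInterval) [IsProbabilityMeasure ν] (hν : ν (Set.Ioo 0 1) ≠ 0)
    {Ω' : Type*} [MeasurableSpace Ω'] (P' : Measure Ω') [IsProbabilityMeasure P']
    (B : ℝ≥0 → Ω' → ℝ) (hB : IsBrownianReal B P')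
    (q : ℝ) (hq : q = quantile P' (pivot ν B) (1 - α))
    (m : ℕ → ℕ)
    -- the change point estimator, for each true change `δ`
    (khat : ∀ n, (Fin (p n) → ℝ) → Ω n → ℕ)
    (hkhat_meas : ∀ n δ, Measurable (khat n δ))
    (hkhat : ∀ n, 1 ≤ n → ∀ δ ω,
      IsChangePointEstimate n (obs (μ n) δ (k₀ n) (U n) ω) (khat n δ ω))
    -- the sum of the spectral norms of the autocovariances is `o(‖Γ̄‖_F)`
    (hsummable : ∀ n, Summable fun h : ℕ => spectralNorm (autocov (P n) (U n) h))
    (hspectral : (fun n => ∑' h : ℕ, spectralNorm (autocov (P n) (U n) h))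
      =o[atTop] fun n => frobNorm (gammaBar (P n) (U n)))
    -- condition on the trace
    (htrace : (fun n => (gammaBar (P n) (U n)).trace ^ 2)
      =O[atTop] fun n => frobNorm (gammaBar (P n) (U n)) ^ 2)
    -- condition on the fourth order cumulants
    (hcum : ∃ K : ℝ, ∃ r ∈ Set.Ioo (0 : ℝ) 1, ∀ᶠ n in atTop, CumulantBound (P n) (U n) K r)
    -- condition on the trimming parameter
    (hm : Tendsto m atTop atTop)
    (hmn : (fun n => (m n : ℝ) ^ (3 / 2 : ℝ)) =o[atTop] fun n => (n : ℝ))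
    -- the noise level does not vanish faster than `1 / n`
    (hnoise : (fun n => (p n : ℝ)) =O[atTop] fun n => (n : ℝ) * frobNorm (gammaBar (P n) (U n))) :
    liminf (fun n => ⨅ δ ∈ alternatives Δ (gammaBar (P n) (U n)),
        P n {ω | Rejects ν q Δ n (m n) (khat n δ ω) (obs (μ n) δ (k₀ n) (U n) ω)}) atTop = 1 ∧
    limsup (fun n => ⨆ δ ∈ nulls C Δ (gammaBar (P n) (U n)),
        P n {ω | Rejects ν q Δ n (m n) (khat n δ ω) (obs (μ n) δ (k₀ n) (U n) ω)}) atTop = 0 := by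
  have hS : ∀ n, IsCentredStationary (P n) (U n) := fun n => by
    have hs := hsummable n
    rw [hU n] at hs ⊢
    exact (hmodel n).isCentredStationary hs
  obtain ⟨ζ, hζ0, hζ1, hζΔ⟩ : ∃ ζ : ℝ, 0 < ζ ∧ ζ * (1 + |q|) < 1 / 2 ∧
      ζ * (1 + |q|) * (2 * Δ) < 1 := by
    refine ⟨min (1 / 4) (1 / (4 * Δ)) / (1 + |q|), by positivity, ?_, ?_⟩
    · rw [div_mul_cancel₀ _ (by positivity)]
      exact (min_le_left _ _).trans_lt (by norm_num)
    · rw [div_mul_cancel₀ _ (by positivity)]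
      calc _ ≤ 1 / (4 * Δ) * (2 * Δ) := by gcongr; exact min_le_right _ _
        _ = 1 / 2 := by field_simp; norm_num
        _ < 1 := by norm_num
  -- On 𝒜_n the bounds c₁ ≤ 1 and c₁ ≤ Δ suffice, as D exceeds both g and Δ. On ℬ_n, c₁ ≤ C gives
  -- the first bound, and c₁ g ≤ (C / Δ) Δ = C gives the second because g < Δ there.
  set c₁ : ℝ := min (min 1 Δ) (min C (C / Δ)) with hc₁
  have hc₁0 : 0 < c₁ := by positivity
  have main : ∀ η : ℝ, 0 < η → _ := fun η hη =>
    eventually_measure_stat_sub_le P p hp ϑ₀ hϑ₀ k₀ hk₀ U hS μ ν m khat hkhat hspectral htrace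
      (isLittleO_of_rpow_isLittleO hmn) hnoise hc₁0 hζ0 hη
  constructor
  · refine le_antisymm ?_ ?_
    · refine (liminf_le_liminf (Eventually.of_forall fun n => ?_)).trans_eq (liminf_const (1 : ℝ≥0∞))
      obtain ⟨δ, hδ⟩ := alternatives_nonempty (hp n) Δ (gammaBar (P n) (U n))
      exact (iInf₂_le δ hδ).trans prob_le_one
    · refine ENNReal.le_of_forall_pos_le_add fun η hη _ => ?_
      rw [← tsub_le_iff_right]
      refine le_liminf_of_le (by isBoundedDefault) ?_
      filter_upwards [main η (by exact_mod_cast hη)] with n ⟨hF, hn⟩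
      refine le_iInf₂ fun δ hδ => ?_
      have hp' : (0 : ℝ) < p n := by exact_mod_cast hp n
      have hg : 0 < frobNorm (gammaBar (P n) (U n)) / p n := by positivity
      have hδ' : Δ + frobNorm (gammaBar (P n) (U n)) / p n < normSq δ := hδ
      have hb := hn δ (by
        have : c₁ ≤ Δ := (min_le_left _ _).trans (min_le_right _ _)
        linarith) (by
        have : c₁ ≤ 1 := (min_le_left _ _).trans (min_le_left _ _)
        have := mul_le_mul_of_nonneg_right this hg.le
        linarith)
      rw [ENNReal.ofReal_coe_nnreal] at hb
      rw [tsub_le_iff_right]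
      -- Covering the space by the rejection event and the bad event uses only subadditivity, so
      -- neither event has to be shown measurable.
      calc (1 : ℝ≥0∞) = P n Set.univ := measure_univ.symm
        _ ≤ P n (_ ∪ _) := measure_mono fun ω _ => ?_
        _ ≤ _ := measure_union_le _ _
        _ ≤ _ := add_le_add le_rfl hb
      by_cases hω : ω ∈ {ω | Rejects ν q Δ n (m n) (khat n δ ω) (obs (μ n) δ (k₀ n) (U n) ω)}
      · exact Or.inl hω
      · exact Or.inr fun h => hω (rejects_of_mem_alternatives hΔ (lt_min one_pos hg)
          (min_le_left _ _) (min_le_right _ _) hζ0.le hζ1 hζΔ hδ' h.1 h.2)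
  · refine le_antisymm ?_ zero_le
    refine ENNReal.le_of_forall_pos_le_add fun η hη _ => ?_
    rw [zero_add]
    refine limsup_le_of_le (by isBoundedDefault) ?_
    filter_upwards [main η (by exact_mod_cast hη)] with n ⟨hF, hn⟩
    refine iSup₂_le fun δ hδ => ?_
    have hp' : (0 : ℝ) < p n := by exact_mod_cast hp n
    have hg : 0 < frobNorm (gammaBar (P n) (U n)) / p n := by positivity
    obtain ⟨hδ1, hδ2⟩ : C ≤ normSq δ ∧ normSq δ < Δ - frobNorm (gammaBar (P n) (U n)) / p n := hδ
    have hb := hn δ (((min_le_right _ _).trans (min_le_left _ _)).trans hδ1) (by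
      have h1 : c₁ ≤ C / Δ := (min_le_right _ _).trans (min_le_right _ _)
      calc c₁ * (frobNorm (gammaBar (P n) (U n)) / p n) ≤ C / Δ * Δ := by
            gcongr
            linarith
        _ = C := by field_simp
        _ ≤ _ := hδ1)
    rw [ENNReal.ofReal_coe_nnreal] at hb
    refine (measure_mono fun ω hω => ?_).trans hb
    exact fun h => not_rejects_of_mem_nulls hΔ (lt_min one_pos hg) (min_le_right _ _) hζ0.le hζΔ
      hδ2 h.1 h.2 hω
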